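/- Let $n,q\in\mathbb N=\{1,2,\dots\}$ with $q\ge 2$, let $p=(p_1,\dots,p_{q-1})\in\mathbb N_0^{q-1}$ with $I:=\{i : p_i\neq 0\}\neq\varnothing$, put $|p|_1=\sum_i p_i$, and let $Q\in\mathbb R[X_1,\dots,X_n]$ be a polynomial of degree $d$ (with $d=0$ if $Q=0$). Let $|\cdot|$ be the Euclidean norm. A vector $v\in\mathbb R^n$ is badly approximable if there are $\delta>0$ and $c>0$ with $|u\cdot v-m|\ge c\,|u|^{-\delta}$ for all $u\in\mathbb Z^n\setminus\{0\}$ and $m\in\mathbb Z$; a matrix $M\in M_n(\mathbb R)$ is badly approximable if ${}^tM u$ is a badly approximable vector for some $u\in\mathbb Z^n$. A family $\tilde a=(\tilde a_l)_{l\in(\mathbb Z^n)^{2q}}$ of complex numbers is Schwartz if $(1+|l_1|^2+\dots+|l_{2q}|^2)^r|\tilde a_l|^2$ is bounded in $l$ for every $r\in\mathbb N_0$. For $l=(l_1,\dots,l_{2q})$ and $1\le i\le q-1$ put $\tilde l_i:=l_1+\dots+l_i+l_{q+1}+\dots+l_{q+i}$. Let $\Theta\in M_n(\mathbb R)$ be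 such that $\frac1{2\pi}\Theta$ is badly approximable and let $\tilde a$ be Schwartz. (i) The double series $$f(s):=\sum_{l\in(\mathbb Z^n)^{2q}}\tilde a_l\sum_{k\in\mathbb Z^n\setminus\{0\}}\ \prod_{i=1}^{q-1}|k+\tilde l_i|^{p_i}\,|k|^{-s}\,Q(k)\,e^{i k\cdot\Theta\sum_{j=1}^q l_j}$$ converges absolutely for $\Re(s)>n+d+|p|_1$, and $f$ has a meromorphic continuation to the whole complex plane $\mathbb C$, with at most simple poles, all of which lie among the points $s=n+d+|p|_1-m$, $m\in\mathbb N_0$. (ii) Let $X=(X_1,\dots,X_n)$, $Y=(Y_1,\dots,Y_{2q})$ with $Y_j=(Y_{j,1},\dots,Y_{j,n})$, and $\tilde Y_i:=Y_1+\dots+Y_i+Y_{q+1}+\dots+Y_{q+i}$. For $\alpha=(\alpha_{i,j})_{i\in I,\,1\le j\le p_i}\in\mathcal I:=\prod_{i\in I}\mathbb N_0^{p_i}$ put $|\alpha|_1=\sum_{i,j}\alpha_{i,j}$, $\binom{1/2}{\alpha}=\prod_{i,j}\binom{1/2}{\alpha_{i,j}}$ and $$P_\alpha(X,Y):=\prod_{i\in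 I}\prod_{j=1}^{p_i}\bigl(2\langle X,\tilde Y_i\rangle+|\tilde Y_i|^2\bigr)^{\alpha_{i,j}},$$ where $|\tilde Y_i|^2=\langle \tilde Y_i,\tilde Y_i\rangle$. For $\beta\in\mathbb N_0^{(2q+1)n}$, let $X^\beta$ be the monomial in $X$ formed with the first $n$ entries of $\beta$, $d_\beta:=\sum_{t=1}^n\beta_t$ its degree, and $Y^\beta$ the monomial in $Y$ formed with the remaining $2qn$ entries. Let $L(\alpha)$ be the set of $\beta$ with $|\beta|_1-d_\beta\le 2|\alpha|_1$ and $d_\beta\le|\alpha|_1+d$, define $c_{\alpha,\beta}\in\mathbb R$ by $$\binom{1/2}{\alpha}P_\alpha(X,Y)\,Q(X)=\sum_{\beta\in L(\alpha)}c_{\alpha,\beta}X^\beta Y^\beta ,$$ and put $M_{\alpha,\beta}(Y):=c_{\alpha,\beta}Y^\beta$. For $m\in\mathbb N_0$ let $$I(m):=\{(\alpha,\beta)\in\mathcal I\times\mathbb N_0^{(2q+1)n} : \beta\in L(\alpha),\ m=2|\alpha|_1-d_\beta+d\}.$$ Then, for every $m\in\mathbb N_0$, the set $I(m)$ is finite,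 the series $$C(f,m):=\sum_{l\in Z}\tilde a_l\sum_{(\alpha,\beta)\in I(m)}M_{\alpha,\beta}(l)\int_{S^{n-1}}u^\beta\,dS(u),\qquad Z:=\Bigl\{l\in(\mathbb Z^n)^{2q} : \sum_{j=1}^q l_j=0\Bigr\},$$ converges absolutely (here $u^\beta=u_1^{\beta_1}\cdots u_n^{\beta_n}$, $dS$ is the surface measure of the unit sphere $S^{n-1}$, counting measure on $\{\pm1\}$ if $n=1$, and an empty sum is $0$), and the point $s=n+d+|p|_1-m$ is a pole of $f$ if and only if $C(f,m)\neq0$. In that case it is a simple pole, and $$\operatorname*{Res}_{s=n+d+|p|_1-m} f(s)=C(f,m).$$ -/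

import Mathlib

open scoped Real Topology

noncomputable section

namespace TorusZeta

/-! ### Lattice vectors, rapidly decaying sequences, badly approximable matrices -/

/-- An integer vector seen as a real vector. -/
def toReal {n : ℕ} (k : Fin n → ℤ) : Fin n → ℝ := fun i => (k i : ℝ)

/-- The Euclidean norm `|k|` of an integer vector. -/
def vnorm {n : ℕ} (k : Fin n → ℤ) : ℝ := Real.sqrt (∑ i, (k i : ℝ) ^ 2)

/-- Elements `l = (l_1, …, l_q, l_{q+1}, …, l_{2q})` of `[(ℤ^n)^q]^2`: the vectors `l_1, …, l_q`
are `l 0 0, …, l 0 (q-1)` and the vectors `l_{q+1}, …, l_{2q}` are `l 1 0, …, l 1 (q-1)`. -/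
abbrev Lat (n q : ℕ) : Type := Fin 2 → Fin q → Fin n → ℤ

/-- Schwartz sequences on `(ℤ^n)^{2q}`: for every `r`, the quantity
`(1 + |l_1|^2 + ⋯ + |l_{2q}|^2)^r |a_l|^2` is bounded. -/
def IsSchwartzSeq {n q : ℕ} (a : Lat n q → ℂ) : Prop :=
  ∀ r : ℕ, ∃ B : ℝ, ∀ l : Lat n q,
    (1 + ∑ e, ∑ j, vnorm (l e j) ^ 2) ^ r * ‖a l‖ ^ 2 ≤ B

/-- A vector `v` is badly approximable: for some `δ > 0` there is `c > 0` with
`|u · v - m| ≥ c |u|^{-δ}` for all nonzero integer vectors `u` and all integers `m`. -/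
def BadlyApproxVec {n : ℕ} (v : Fin n → ℝ) : Prop :=
  ∃ δ : ℝ, 0 < δ ∧ ∃ c : ℝ, 0 < c ∧ ∀ u : Fin n → ℤ, u ≠ 0 → ∀ m : ℤ,
    c * vnorm u ^ (-δ) ≤ |toReal u ⬝ᵥ v - (m : ℝ)|

/-- A matrix `M` is badly approximable: `ᵗM u` is a badly approximable vector for some integer
vector `u`. -/
def BadlyApproxMatrix {n : ℕ} (M : Matrix (Fin n) (Fin n) ℝ) : Prop :=
  ∃ u : Fin n → ℤ, BadlyApproxVec (M.transpose.mulVec (toReal u))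

/-! ### The zeta function -/

/-- The vector `l̃_{i+1} = l_1 + ⋯ + l_{i+1} + l_{q+1} + ⋯ + l_{q+i+1}` (the index `i` starts
at `0`). -/
def tildeVec {n q : ℕ} (l : Lat n q) (i : Fin (q - 1)) : Fin n → ℤ :=
  ∑ j : Fin q with j.val ≤ i.val, (l 0 j + l 1 j)

/-- The vector `l_1 + ⋯ + l_q`. -/
def firstSum {n q : ℕ} (l : Lat n q) : Fin n → ℤ := ∑ j, l 0 j

/-- The summand
`∏_{i=1}^{q-1} |k + l̃_i|^{p_i} |k|^{-s} Q(k) e^{i k · Θ (l_1 + ⋯ + l_q)}`, used for `k ≠ 0`. -/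
def zetaTerm {n q : ℕ} (Θ : Matrix (Fin n) (Fin n) ℝ) (p : Fin (q - 1) → ℕ)
    (Q : MvPolynomial (Fin n) ℝ) (l : Lat n q) (k : Fin n → ℤ) (s : ℂ) : ℂ :=
  ((∏ i, vnorm (k + tildeVec l i) ^ p i : ℝ) : ℂ) * (vnorm k : ℂ) ^ (-s) *
    ((MvPolynomial.eval (toReal k) Q : ℝ) : ℂ) *
    Complex.exp (Complex.I * ((toReal k ⬝ᵥ Θ.mulVec (toReal (firstSum l)) : ℝ) : ℂ))

/-- The zeta function `f(s) = ∑_l a_l ∑'_{k ≠ 0} (summand)`, on its half-plane of absolute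
convergence. -/
def zetaFun {n q : ℕ} (Θ : Matrix (Fin n) (Fin n) ℝ) (p : Fin (q - 1) → ℕ)
    (Q : MvPolynomial (Fin n) ℝ) (a : Lat n q → ℂ) (s : ℂ) : ℂ :=
  ∑' l : Lat n q, a l * ∑' k : {k : Fin n → ℤ // k ≠ 0}, zetaTerm Θ p Q l k s

/-! ### The polynomials `P_α` and the coefficients of `binom(1/2, α) P_α(X, Y) Q(X)` -/

/-- The `(2q+1)n` variables: `X_t` is `Sum.inl t`; `Y_{j+1,t}` and `Y_{q+j+1,t}` (for `j < q`) are
`Sum.inr (0, j, t)` and `Sum.inr (1, j, t)`. -/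
abbrev Var (n q : ℕ) : Type := Fin n ⊕ (Fin 2 × Fin q × Fin n)

/-- Multi-indices `α = (α_i)` with `α_i ∈ ℕ^{p_i}`. The indices `i` with `p_i = 0` carry an empty
tuple, so this is the product over those `i` with `p_i ≠ 0`. -/
abbrev AIdx {q : ℕ} (p : Fin (q - 1) → ℕ) : Type := (i : Fin (q - 1)) → Fin (p i) → ℕ

/-- `|α|_1`. -/
def aDeg {q : ℕ} {p : Fin (q - 1) → ℕ} (α : AIdx p) : ℕ := ∑ i, ∑ j, α i j

/-- `binom(1/2, α) = ∏_i ∏_j binom(1/2, α_{i,j})`. -/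
def aBinom {q : ℕ} {p : Fin (q - 1) → ℕ} (α : AIdx p) : ℝ :=
  ∏ i, ∏ j, Ring.choose (1 / 2 : ℝ) (α i j)

/-- The `t`-th coordinate of `Ỹ_{i+1} = Y_1 + ⋯ + Y_{i+1} + Y_{q+1} + ⋯ + Y_{q+i+1}`. -/
def tildeY {n q : ℕ} (i : Fin (q - 1)) (t : Fin n) : MvPolynomial (Var n q) ℝ :=
  ∑ j : Fin q with j.val ≤ i.val,
    (MvPolynomial.X (Sum.inr (0, j, t)) + MvPolynomial.X (Sum.inr (1, j, t)))

/-- `P_α(X, Y) = ∏_i ∏_j (2⟨X, Ỹ_i⟩ + |Ỹ_i|^2)^{α_{i,j}}`. -/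
def polyP (n : ℕ) {q : ℕ} {p : Fin (q - 1) → ℕ} (α : AIdx p) : MvPolynomial (Var n q) ℝ :=
  ∏ i, ∏ j,
    (2 * (∑ t : Fin n, MvPolynomial.X (Sum.inl t) * tildeY i t) +
      ∑ t : Fin n, tildeY i t ^ 2) ^ α i j

/-- `c_{α,β}`: the coefficient of `X^β Y^β` in `binom(1/2, α) P_α(X, Y) Q(X)`. -/
def coeffC {n q : ℕ} {p : Fin (q - 1) → ℕ} (Q : MvPolynomial (Fin n) ℝ) (α : AIdx p)
    (β : Var n q →₀ ℕ) : ℝ :=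
  MvPolynomial.coeff β
    (MvPolynomial.C (aBinom α) * polyP n α * MvPolynomial.rename Sum.inl Q)

/-- `M_{α,β}(l) = c_{α,β} l^β`, where `l^β` involves the exponents of the `Y`-variables only. -/
def coeffM {n q : ℕ} {p : Fin (q - 1) → ℕ} (Q : MvPolynomial (Fin n) ℝ) (α : AIdx p)
    (β : Var n q →₀ ℕ) (l : Lat n q) : ℝ :=
  coeffC Q α β * ∏ e, ∏ j, ∏ t, (l e j t : ℝ) ^ β (Sum.inr (e, j, t))

/-- `d_β`, the degree of `X^β`. -/
def xDeg {n q : ℕ} (β : Var n q →₀ ℕ) : ℕ := ∑ t, β (Sum.inl t)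

/-- `L(α)`: the `β` with `|β|_1 - d_β ≤ 2|α|_1` and `d_β ≤ |α|_1 + d`, where `d = deg Q`. -/
def setL {n q : ℕ} {p : Fin (q - 1) → ℕ} (Q : MvPolynomial (Fin n) ℝ) (α : AIdx p) :
    Set (Var n q →₀ ℕ) :=
  {β | (β.degree : ℤ) - xDeg β ≤ 2 * aDeg α ∧ xDeg β ≤ aDeg α + Q.totalDegree}

/-- `I(m)`: the pairs `(α, β)` with `β ∈ L(α)` and `m = 2|α|_1 - d_β + d`. -/
def setI {n q : ℕ} (p : Fin (q - 1) → ℕ) (Q : MvPolynomial (Fin n) ℝ) (m : ℕ) :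
    Set (AIdx p × (Var n q →₀ ℕ)) :=
  {x | x.2 ∈ setL Q x.1 ∧ (m : ℤ) = 2 * aDeg x.1 - xDeg x.2 + Q.totalDegree}

/-- `∫_{S^{n-1}} u^β dS(u)`, for the surface measure of the unit sphere of `ℝ^n`; `u^β` involves
the exponents of the `X`-variables only. -/
def sphereInt {n q : ℕ} (β : Var n q →₀ ℕ) : ℝ :=
  ∫ u : Metric.sphere (0 : EuclideanSpace ℝ (Fin n)) 1,
    ∏ t, (u : EuclideanSpace ℝ (Fin n)) t ^ β (Sum.inl t)
    ∂(MeasureTheory.volume : MeasureTheory.Measure (EuclideanSpace ℝ (Fin n))).toSphere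

/-- The term of index `l` in `C(f, m)`:
`a_l ∑_{(α,β) ∈ I(m)} M_{α,β}(l) ∫_{S^{n-1}} u^β dS(u)`. -/
def resTerm {n q : ℕ} (p : Fin (q - 1) → ℕ) (Q : MvPolynomial (Fin n) ℝ) (a : Lat n q → ℂ)
    (m : ℕ) (l : Lat n q) : ℂ :=
  a l * ((∑ᶠ x ∈ setI p Q m, coeffM Q x.1 x.2 l * sphereInt x.2 : ℝ) : ℂ)

/-- `C(f, m)`, the sum of these terms over the `l` with `l_1 + ⋯ + l_q = 0`. -/
def resC {n q : ℕ} (p : Fin (q - 1) → ℕ) (Q : MvPolynomial (Fin n) ℝ) (a : Lat n q → ℂ)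
    (m : ℕ) : ℂ :=
  ∑' l : {l : Lat n q // firstSum l = 0}, resTerm p Q a m l

/-- The point `n + d + |p|_1 - m`. -/
def polePt (n : ℕ) {q : ℕ} (p : Fin (q - 1) → ℕ) (Q : MvPolynomial (Fin n) ℝ) (m : ℕ) : ℂ :=
  (n : ℂ) + Q.totalDegree + ((∑ i, p i : ℕ) : ℂ) - m

/-! ### Residues -/

/-- `f` is meromorphic at `z` with residue `c`: `(2πi)⁻¹ ∮ f = c` along all sufficiently small
circles around `z`. -/
def HasResidueAt (f : ℂ → ℂ) (z c : ℂ) : Prop :=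
  MeromorphicAt f z ∧
    ∀ᶠ r in 𝓝[>] (0 : ℝ), (2 * π * Complex.I)⁻¹ * (∮ w in C(z, r), f w) = c

end TorusZeta

end

/-!
The square roots in `|k + l̃_i| = |k| √(1 + (2⟨k, l̃_i⟩ + |l̃_i|²) / |k|²)` are expanded by the
binomial series, truncated at an order `N`. The error is `O(|k| ^ (-N))` uniformly in `l`, up to a
power of `1 + |l|²` which the Schwartz sequence absorbs (`exists_abs_prod_sub_truncProd_le`); it
contributes a function holomorphic `N` units to the left of the half-plane of absolute convergence
(`exists_remainder`). What is left is a finite sum, over pairs `(α, β)`, of Dirichlet series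
`∑_l b_l ∑_{k ≠ 0} k ^ β exp (2 π i k · x_l) |k| ^ (-s)`
with `b` rapidly decreasing and `x_l = (2π)⁻¹ Θ (l_1 + ⋯ + l_q)`.

Each of these series is `Γ_ℝ(s)⁻¹` times the Mellin transform at `s / 2` of the theta series
`∑_l b_l ∑_{k ≠ 0} k ^ β exp (2 π i k · x_l) exp (-π |k|² t)`.
For fixed `l` the sum over all `k` is a product of one-dimensional theta series, and Poisson
summation (`tsum_comp_div_eq`) describes it as `t → 0`: when `x_l = 0` it is a constant times
`t ^ (-(n + |β|) / 2)` up to `O(t ^ N)` for every `N`, and when some coordinate of `x_l` has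
distance at least `1 / D` to the integers it is `O(D ^ M t ^ N)`. The Diophantine condition on `Θ`
provides such a coordinate with `D` polynomial in `l` as soon as `l_1 + ⋯ + l_q ≠ 0`
(`BadlyApproxMatrix.exists_weight`), so the estimates can be summed over `l` and only the `l` with
`l_1 + ⋯ + l_q = 0` enter the leading term (`puncturedTheta_isBigO_zero`). Hence the Dirichlet
series has a single possible pole, at `n + |β|` (`exists_entire_continuation`); the pole at `0` of
the Mellin transform, due to the missing term `k = 0`, is cancelled by `Γ_ℝ(s)⁻¹`. The residue is
a moment of the unit sphere, by polar coordinates in a Gaussian integral (`prod_thetaConst_eq`).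

Collecting the pairs `(α, β)` with the same pole gives the candidate poles and residues
(`exists_zeta_decomposition`), and the continuations for the various `N` agree by the identity
theorem (`exists_glued_continuation`).
-/

namespace TorusZeta

/-! ### Sums over lattices -/

/-- An absolutely convergent sum over `α ^ n` of products of functions of one variable is the
product of the `n` sums. -/
theorem summable_norm_and_tsum_prod_pi {α R : Type*} [NormedCommRing R] [CompleteSpace R] :
    ∀ (n : ℕ) (f : Fin n → α → R), (∀ i, Summable fun x => ‖f i x‖) →
      (Summable fun k : Fin n → α => ‖∏ i, f i (k i)‖) ∧
        ∑' k : Fin n → α, ∏ i, f i (k i) = ∏ i, ∑' x, f i x := by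
  intro n
  induction n with
  | zero =>
    intro f _
    refine ⟨(hasSum_fintype _).summable, ?_⟩
    simp [tsum_fintype]
  | succ n ih =>
    intro f hf
    obtain ⟨h1, h2⟩ := ih (fun i => f i.succ) (fun i => hf i.succ)
    have h3 := Summable.mul_norm (hf 0) h1
    have key : ∀ z : α × (Fin n → α), ∏ i, f i (Fin.consEquiv (fun _ => α) z i) =
        f 0 z.1 * ∏ i, f (Fin.succ i) (z.2 i) := by
      intro z
      simp [Fin.prod_univ_succ, Fin.consEquiv]
    constructor
    · rw [← (Fin.consEquiv (fun _ => α)).summable_iff]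
      refine h3.congr fun z => ?_
      simp only [Function.comp_apply, key]
    · rw [← (Fin.consEquiv (fun _ => α)).tsum_eq]
      simp only [key]
      rw [← tsum_mul_tsum_of_summable_norm (hf 0) h1, h2, Fin.prod_univ_succ]

/-- A product depends on its factors in a Lipschitz way, as long as they are bounded. -/
theorem norm_prod_sub_prod_le_of_le {ι R : Type*} [NormedCommRing R] [NormOneClass R]
    (s : Finset ι) (f g : ι → R)
    {A ε : ℝ} (hA : 1 ≤ A) (hf : ∀ i ∈ s, ‖f i‖ ≤ A) (hg : ∀ i ∈ s, ‖g i‖ ≤ A)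
    (h : ∀ i ∈ s, ‖f i - g i‖ ≤ ε) :
    ‖∏ i ∈ s, f i - ∏ i ∈ s, g i‖ ≤ s.card * A ^ s.card * ε := by
  classical
  induction s using Finset.induction_on with
  | empty => simp
  | insert i s hi ih =>
    have hε : 0 ≤ ε := (norm_nonneg _).trans (h i (Finset.mem_insert_self _ _))
    have hP : ‖∏ j ∈ s, f j‖ ≤ A ^ s.card := by
      refine (Finset.norm_prod_le _ _).trans ?_
      refine (Finset.prod_le_prod (fun _ _ => norm_nonneg _)
        (fun j hj => hf j (Finset.mem_insert_of_mem hj))).trans ?_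
      simp
    have ih' := ih (fun j hj => hf j (Finset.mem_insert_of_mem hj))
      (fun j hj => hg j (Finset.mem_insert_of_mem hj))
      (fun j hj => h j (Finset.mem_insert_of_mem hj))
    rw [Finset.prod_insert hi, Finset.prod_insert hi, Finset.card_insert_of_notMem hi]
    have e : f i * ∏ j ∈ s, f j - g i * ∏ j ∈ s, g j =
        (f i - g i) * ∏ j ∈ s, f j + g i * (∏ j ∈ s, f j - ∏ j ∈ s, g j) := by ring
    rw [e]
    have hA0 : (0:ℝ) ≤ A := zero_le_one.trans hA
    calc _ ≤ ‖f i - g i‖ * ‖∏ j ∈ s, f j‖ + ‖g i‖ * ‖∏ j ∈ s, f j - ∏ j ∈ s, g j‖ :=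
          (norm_add_le _ _).trans (add_le_add (norm_mul_le _ _) (norm_mul_le _ _))
      _ ≤ ε * A ^ s.card + A * (s.card * A ^ s.card * ε) := by
          gcongr
          · exact h i (Finset.mem_insert_self _ _)
          · exact hg i (Finset.mem_insert_self _ _)
      _ ≤ ε * A ^ (s.card + 1) + A * (s.card * A ^ s.card * ε) := by
          gcongr
          exact Nat.le_succ _
      _ = _ := by push_cast; ring

theorem summable_max_one_abs_rpow {s : ℝ} (hs : 1 < s) :
    Summable fun k : ℤ => (max 1 |(k : ℝ)|) ^ (-s) := by
  refine (summable_congr_cofinite ?_).mpr (Real.summable_abs_int_rpow hs)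
  rw [Filter.eventuallyEq_iff_exists_mem]
  refine ⟨{0}ᶜ, (Set.finite_singleton 0).compl_mem_cofinite, fun k hk => ?_⟩
  have : (1 : ℝ) ≤ |(k : ℝ)| := by exact_mod_cast Int.one_le_abs hk
  simp [max_eq_right this]

theorem vnorm_nonneg {n : ℕ} (k : Fin n → ℤ) : 0 ≤ vnorm k := Real.sqrt_nonneg _

theorem vnorm_sq {n : ℕ} (k : Fin n → ℤ) : vnorm k ^ 2 = ∑ i, (k i : ℝ) ^ 2 :=
  Real.sq_sqrt (Finset.sum_nonneg fun _ _ => sq_nonneg _)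

theorem abs_le_vnorm {n : ℕ} (k : Fin n → ℤ) (i : Fin n) : |(k i : ℝ)| ≤ vnorm k := by
  refine abs_le_of_sq_le_sq ?_ (vnorm_nonneg k)
  rw [vnorm_sq]
  exact Finset.single_le_sum (f := fun i => (k i : ℝ) ^ 2) (fun _ _ => sq_nonneg _)
    (Finset.mem_univ i)

theorem one_le_vnorm {n : ℕ} {k : Fin n → ℤ} (hk : k ≠ 0) : 1 ≤ vnorm k := by
  obtain ⟨i, hi⟩ := Function.ne_iff.mp hk
  refine le_trans ?_ (abs_le_vnorm k i)
  exact_mod_cast Int.one_le_abs hi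

theorem vnorm_le_sum_abs {n : ℕ} (k : Fin n → ℤ) : vnorm k ≤ ∑ i, |(k i : ℝ)| := by
  refine Real.sqrt_le_iff.mpr ⟨Finset.sum_nonneg fun _ _ => abs_nonneg _, ?_⟩
  simpa using Finset.sum_sq_le_sq_sum_of_nonneg (s := Finset.univ) (f := fun i => |(k i : ℝ)|)
    (fun _ _ => abs_nonneg _)

theorem summable_vnorm_rpow {n : ℕ} {r : ℝ} (hr : (n : ℝ) < r) :
    Summable fun k : {k : Fin n → ℤ // k ≠ 0} => vnorm k.1 ^ (-r) := by
  rcases Nat.eq_zero_or_pos n with rfl | hn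
  · have : IsEmpty {k : Fin 0 → ℤ // k ≠ 0} := ⟨fun k => k.2 (Subsingleton.elim _ _)⟩
    exact summable_empty
  have hn' : (0 : ℝ) < n := by exact_mod_cast hn
  have h1 : 1 < r / n := by rwa [one_lt_div hn']
  have h := (summable_norm_and_tsum_prod_pi n
    (fun (_ : Fin n) (k : ℤ) => (max 1 |(k : ℝ)|) ^ (-(r / n)))
    (fun _ => (summable_max_one_abs_rpow h1).norm)).1
  refine Summable.of_nonneg_of_le (fun k => Real.rpow_nonneg (vnorm_nonneg _) _) (fun k => ?_)
    (h.comp_injective (Subtype.val_injective (p := fun k : Fin n → ℤ => k ≠ 0)))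
  have hk := one_le_vnorm k.2
  simp only [Function.comp_apply]
  rw [Real.norm_of_nonneg (Finset.prod_nonneg fun i _ => by positivity)]
  calc vnorm k.1 ^ (-r) = ∏ _i : Fin n, vnorm k.1 ^ (-(r / n)) := by
        rw [Finset.prod_const, ← Real.rpow_natCast, ← Real.rpow_mul (vnorm_nonneg _)]
        congr 1
        simp only [Finset.card_univ, Fintype.card_fin]
        field_simp
    _ ≤ _ := by
        refine Finset.prod_le_prod (fun i _ => Real.rpow_nonneg (vnorm_nonneg _) _) fun i _ => ?_
        exact Real.rpow_le_rpow_of_nonpos (by positivity) (max_le hk (abs_le_vnorm _ i))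
          (by linarith)

/-- The weight `1 + |l_1|^2 + ⋯ + |l_{2q}|^2` measuring the growth of functions of `l`. -/
noncomputable def latWeight {n q : ℕ} (l : Lat n q) : ℝ := 1 + ∑ e, ∑ j, vnorm (l e j) ^ 2

theorem one_le_latWeight {n q : ℕ} (l : Lat n q) : 1 ≤ latWeight l := by
  unfold latWeight
  have : 0 ≤ ∑ e, ∑ j, vnorm (l e j) ^ 2 :=
    Finset.sum_nonneg fun _ _ => Finset.sum_nonneg fun _ _ => sq_nonneg _
  linarith

theorem one_add_vnorm_sq_le_latWeight {n q : ℕ} (l : Lat n q) (e : Fin 2) (j : Fin q) :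
    1 + vnorm (l e j) ^ 2 ≤ latWeight l := by
  unfold latWeight
  have h1 : vnorm (l e j) ^ 2 ≤ ∑ j, vnorm (l e j) ^ 2 :=
    Finset.single_le_sum (f := fun j => vnorm (l e j) ^ 2) (fun _ _ => sq_nonneg _)
      (Finset.mem_univ j)
  have h2 : ∑ j, vnorm (l e j) ^ 2 ≤ ∑ e, ∑ j, vnorm (l e j) ^ 2 :=
    Finset.single_le_sum (f := fun e => ∑ j, vnorm (l e j) ^ 2)
      (fun _ _ => Finset.sum_nonneg fun _ _ => sq_nonneg _) (Finset.mem_univ e)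
  linarith

theorem vnorm_le_latWeight {n q : ℕ} (l : Lat n q) (e : Fin 2) (j : Fin q) :
    vnorm (l e j) ≤ latWeight l := by
  nlinarith [one_add_vnorm_sq_le_latWeight l e j, sq_nonneg (vnorm (l e j) - 1)]

theorem summable_one_add_sq_inv : Summable fun k : ℤ => ‖(1 + (k : ℝ) ^ 2)⁻¹‖ := by
  refine Summable.of_nonneg_of_le (fun _ => norm_nonneg _) (fun k => ?_)
    (summable_max_one_abs_rpow one_lt_two)
  rw [Real.norm_of_nonneg (by positivity), Real.rpow_neg (by positivity), Real.rpow_two]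
  refine inv_anti₀ (by positivity) ?_
  rcases max_choice (1 : ℝ) |(k : ℝ)| with h | h <;> rw [h]
  · nlinarith [sq_nonneg (k : ℝ)]
  · rw [sq_abs]; linarith

/-- A Schwartz sequence stays absolutely summable against any power of the weight. -/
theorem IsSchwartzSeq.summable {n q : ℕ} {a : Lat n q → ℂ} (ha : IsSchwartzSeq a) (N : ℕ) :
    Summable fun l => ‖a l‖ * latWeight l ^ N := by
  -- the weight dominates each of the `2 * q * n` factors `1 + l_{j,t} ^ 2`, so its power of order
  -- `2 * q * n` makes the sum over `l` converge
  obtain ⟨B, hB⟩ := ha (2 * (N + 2 * q * n))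
  have h := (summable_norm_and_tsum_prod_pi 2
    (fun (_ : Fin 2) (x : Fin q → Fin n → ℤ) => ∏ j, ∏ t, (1 + (x j t : ℝ) ^ 2)⁻¹)
    (fun _ => (summable_norm_and_tsum_prod_pi q
      (fun (_ : Fin q) (x : Fin n → ℤ) => ∏ t, (1 + (x t : ℝ) ^ 2)⁻¹)
      (fun _ => (summable_norm_and_tsum_prod_pi n (fun (_ : Fin n) (x : ℤ) =>
        (1 + (x : ℝ) ^ 2)⁻¹) (fun _ => summable_one_add_sq_inv)).1)).1)).1
  refine Summable.of_nonneg_of_le (fun l => ?_) (fun l => ?_) (h.mul_left (√B))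
  · have := one_le_latWeight l
    positivity
  have hW := one_le_latWeight l
  have hW0 : 0 < latWeight l := zero_lt_one.trans_le hW
  have h1 : ‖a l‖ * latWeight l ^ (N + 2 * q * n) ≤ √B := by
    refine Real.le_sqrt_of_sq_le ?_
    have := hB l
    calc _ = latWeight l ^ (2 * (N + 2 * q * n)) * ‖a l‖ ^ 2 := by rw [pow_mul]; ring
      _ ≤ B := this
  have h2 : (latWeight l ^ (2 * q * n))⁻¹ ≤ ∏ e, ∏ j, ∏ t, (1 + (l e j t : ℝ) ^ 2)⁻¹ := by
    calc (latWeight l ^ (2 * q * n))⁻¹ = ∏ _e : Fin 2, ∏ _j : Fin q, ∏ _t : Fin n,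
          (latWeight l)⁻¹ := by
          simp only [Finset.prod_const, Finset.card_univ, Fintype.card_fin, ← pow_mul, inv_pow]
          congr 2
          ring
      _ ≤ _ := by
          have hi : 0 ≤ (latWeight l)⁻¹ := by positivity
          refine Finset.prod_le_prod (fun _ _ => by positivity) fun e _ => ?_
          refine Finset.prod_le_prod (fun _ _ => by positivity) fun j _ => ?_
          refine Finset.prod_le_prod (fun _ _ => by positivity) fun t _ => ?_
          refine inv_anti₀ (by positivity) (le_trans ?_ (one_add_vnorm_sq_le_latWeight l e j))
          rw [vnorm_sq]
          have := Finset.single_le_sum (f := fun t => (l e j t : ℝ) ^ 2)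
            (fun _ _ => sq_nonneg _) (Finset.mem_univ t)
          simpa using this
  rw [Real.norm_of_nonneg (by positivity)]
  calc ‖a l‖ * latWeight l ^ N
      = (‖a l‖ * latWeight l ^ (N + 2 * q * n)) * (latWeight l ^ (2 * q * n))⁻¹ := by
        rw [pow_add]; field_simp
    _ ≤ _ := by gcongr

/-! ### Poisson summation for rescaled Schwartz functions -/

open scoped SchwartzMap FourierTransform

theorem exists_one_add_abs_pow_mul_norm_le (h : 𝓢(ℝ, ℂ)) (N : ℕ) :
    ∃ C : ℝ, 0 ≤ C ∧ ∀ y, (1 + |y|) ^ N * ‖h y‖ ≤ C := by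
  refine ⟨2 ^ N * (Finset.Iic (N, 0)).sup (fun m => SchwartzMap.seminorm ℝ m.1 m.2) h,
    mul_nonneg (by positivity) (apply_nonneg _ _), fun y => ?_⟩
  have := SchwartzMap.one_add_le_sup_seminorm_apply (𝕜 := ℝ) (m := (N, 0)) le_rfl le_rfl h y
  simpa using this

theorem exists_norm_le_max_one_abs (h : 𝓢(ℝ, ℂ)) {τ : ℝ} (hτ : 0 < τ) :
    ∃ C : ℝ, ∀ k : ℤ, ‖h (τ * k)‖ ≤ C * (max 1 |(k : ℝ)|) ^ (-2 : ℝ) := by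
  obtain ⟨C, hC0, hC⟩ := exists_one_add_abs_pow_mul_norm_le h 2
  refine ⟨C * (min 1 τ ^ 2)⁻¹, fun k => ?_⟩
  have hm : 0 < min 1 τ := lt_min one_pos hτ
  have h1 : min 1 τ * max 1 |(k : ℝ)| ≤ 1 + |τ * k| := by
    rw [abs_mul, abs_of_pos hτ]
    rcases max_choice (1 : ℝ) |(k : ℝ)| with h | h <;> rw [h]
    · have := min_le_left 1 τ
      have : 0 ≤ τ * |(k : ℝ)| := by positivity
      linarith
    · have := mul_le_mul_of_nonneg_right (min_le_right 1 τ) (abs_nonneg (k : ℝ))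
      linarith
  have h2 := hC (τ * k)
  rw [Real.rpow_neg (by positivity), Real.rpow_two, mul_assoc, ← mul_inv, ← div_eq_mul_inv,
    le_div_iff₀ (by positivity), ← mul_pow]
  calc _ ≤ ‖h (τ * k)‖ * (1 + |τ * k|) ^ 2 := by gcongr
    _ ≤ C := by linarith

/-- The Poisson summation formula for the rescaled function `y ↦ h (y / τ)`. -/
theorem tsum_comp_div_eq (h : 𝓢(ℝ, ℂ)) {τ : ℝ} (hτ : 0 < τ) (x : ℝ) :
    ∑' m : ℤ, h ((x + m) / τ) =
      ∑' k : ℤ, τ * (𝓕 h) (τ * k) * Complex.exp (2 * π * Complex.I * k * x) := by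
  let e : ℝ ≃L[ℝ] ℝ := ContinuousLinearEquiv.smulLeft (Units.mk0 τ⁻¹ (inv_ne_zero hτ.ne'))
  have he : ∀ y, e y = y / τ := fun y => by
    simp [e, Units.smul_def, div_eq_inv_mul]
  have hp := SchwartzMap.tsum_eq_tsum_fourier (SchwartzMap.compCLMOfContinuousLinearEquiv ℂ e h) x
  simp only [SchwartzMap.compCLMOfContinuousLinearEquiv_apply, Function.comp_apply, he] at hp
  rw [hp]
  refine tsum_congr fun k => ?_
  rw [fourier_coe_apply]
  have hF : (𝓕 (SchwartzMap.compCLMOfContinuousLinearEquiv ℂ e h)) (k : ℝ) =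
      (τ : ℂ) * (𝓕 h) (τ * k) := by
    rw [SchwartzMap.fourier_coe, SchwartzMap.fourier_coe, Real.fourier_real_eq,
      Real.fourier_real_eq]
    simp only [SchwartzMap.compCLMOfContinuousLinearEquiv_apply, Function.comp_apply, he]
    have := MeasureTheory.Measure.integral_comp_div
      (fun v : ℝ => Real.fourierChar (-(v * (τ * k))) • h v) τ
    rw [abs_of_pos hτ] at this
    rw [← smul_eq_mul, Complex.coe_smul, ← this]
    congr 1
    ext v
    congr 3
    field_simp
  rw [hF]
  simp

/-- The sum over a lattice translate of `(1 + |·|) ^ (-2)` is bounded independently of the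
translation. -/
theorem summable_and_tsum_translate_le (x : ℝ) :
    (Summable fun m : ℤ => ((1 + |x + m|) ^ 2)⁻¹) ∧
      ∑' m : ℤ, ((1 + |x + m|) ^ 2)⁻¹ ≤ ∑' m : ℤ, (max 1 |(m : ℝ)|) ^ (-2 : ℝ) := by
  have hs := summable_max_one_abs_rpow one_lt_two
  have hs' := (Equiv.addRight ⌊x⌋).summable_iff.mpr hs
  have hle : ∀ m : ℤ, ((1 + |x + m|) ^ 2)⁻¹ ≤
      ((fun m : ℤ => (max 1 |(m : ℝ)|) ^ (-2 : ℝ)) ∘ Equiv.addRight ⌊x⌋) m := by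
    intro m
    simp only [Function.comp_apply, Equiv.coe_addRight]
    rw [Real.rpow_neg (by positivity), Real.rpow_two]
    refine inv_anti₀ (by positivity) (pow_le_pow_left₀ (by positivity) (max_le ?_ ?_) 2)
    · linarith [abs_nonneg (x + m)]
    · push_cast
      have h1 : ((m : ℝ) + ⌊x⌋) = (x + m) - Int.fract x := by rw [Int.fract]; ring
      rw [h1]
      have h2 := abs_sub (x + m) (Int.fract x)
      have h3 := abs_of_nonneg (Int.fract_nonneg x)
      have h4 := Int.fract_lt_one x
      linarith
  have hS : Summable fun m : ℤ => ((1 + |x + m|) ^ 2)⁻¹ :=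
    Summable.of_nonneg_of_le (fun m => by positivity) hle hs'
  exact ⟨hS, (hS.tsum_le_tsum hle hs').trans_eq ((Equiv.addRight ⌊x⌋).tsum_eq
    fun m : ℤ => (max 1 |(m : ℝ)|) ^ (-2 : ℝ))⟩

/-- The disjunction in `hy` allows `y` to be close to `0` when no decay in `τ` is claimed. -/
theorem norm_comp_div_le {h : 𝓢(ℝ, ℂ)} {N : ℕ} {C : ℝ}
    (hC : ∀ y, (1 + |y|) ^ (N + 2) * ‖h y‖ ≤ C) {τ : ℝ} (hτ : 0 < τ) (hτ1 : τ ≤ 1)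
    {D : ℝ} (hD : 1 ≤ D) {y : ℝ} (hy : N = 0 ∨ D⁻¹ ≤ |y|) :
    ‖h (y / τ)‖ ≤ C * D ^ N * τ ^ N * ((1 + |y|) ^ 2)⁻¹ := by
  have hD0 : 0 < D := one_pos.trans_le hD
  have h1 : |y| ≤ |y / τ| := by
    rw [abs_div, abs_of_pos hτ]
    exact le_div_self (abs_nonneg _) hτ hτ1
  have h2 : ((D * τ) ^ N)⁻¹ ≤ (1 + |y / τ|) ^ N := by
    rcases hy with rfl | hy
    · simp
    · rw [← inv_pow]
      refine pow_le_pow_left₀ (by positivity) ?_ N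
      rw [abs_div, abs_of_pos hτ, mul_inv, ← div_eq_mul_inv]
      have : D⁻¹ / τ ≤ |y| / τ := by gcongr
      linarith
  have h3 := hC (y / τ)
  rw [← div_eq_mul_inv, le_div_iff₀ (by positivity)]
  have h4 : ((D * τ) ^ N)⁻¹ * (‖h (y / τ)‖ * (1 + |y|) ^ 2) ≤ C := by
    calc _ ≤ (1 + |y / τ|) ^ N * (‖h (y / τ)‖ * (1 + |y / τ|) ^ 2) := by gcongr
      _ = (1 + |y / τ|) ^ (N + 2) * ‖h (y / τ)‖ := by ring
      _ ≤ C := h3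
  rw [inv_mul_le_iff₀ (by positivity), mul_pow] at h4
  linarith

/-- For a Schwartz function `h`, the behaviour of `∑ h ((x + m) / τ)` as `τ → 0`: the sum is
bounded, it tends to zero rapidly when `x` stays away from the integers, with a polynomial
dependence on the distance, and it tends to `h 0` rapidly when `x = 0`. -/
theorem exists_tsum_comp_div_bounds (h : 𝓢(ℝ, ℂ)) (N : ℕ) :
    ∃ C : ℝ, 0 ≤ C ∧ ∀ τ : ℝ, 0 < τ → τ ≤ 1 →
      (∀ x : ℝ, ‖∑' m : ℤ, h ((x + m) / τ)‖ ≤ C) ∧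
      (∀ x D : ℝ, 1 ≤ D → (∀ m : ℤ, D⁻¹ ≤ |x + m|) →
        ‖∑' m : ℤ, h ((x + m) / τ)‖ ≤ C * D ^ N * τ ^ N) ∧
      ‖∑' m : ℤ, h ((0 + m) / τ) - h 0‖ ≤ C * τ ^ N := by
  obtain ⟨C₀, hC₀, h₀⟩ := exists_one_add_abs_pow_mul_norm_le h (0 + 2)
  obtain ⟨C₁, hC₁, h₁⟩ := exists_one_add_abs_pow_mul_norm_le h (N + 2)
  set K : ℝ := ∑' m : ℤ, (max 1 |(m : ℝ)|) ^ (-2 : ℝ)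
  have hK : 0 ≤ K := tsum_nonneg fun m => by positivity
  have main : ∀ (f : ℤ → ℂ) (x A : ℝ), 0 ≤ A →
      (∀ m : ℤ, ‖f m‖ ≤ A * ((1 + |x + m|) ^ 2)⁻¹) → ‖∑' m, f m‖ ≤ A * K := by
    intro f x A hA hf
    obtain ⟨hs, hle⟩ := summable_and_tsum_translate_le x
    refine (tsum_of_norm_bounded (hs.mul_left A).hasSum hf).trans ?_
    rw [tsum_mul_left]
    exact mul_le_mul_of_nonneg_left hle hA
  refine ⟨max C₀ C₁ * K, by positivity, fun τ hτ hτ1 => ⟨fun x => ?_, fun x D hD hx => ?_, ?_⟩⟩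
  · refine main _ x _ (by positivity) fun m => ?_
    refine (norm_comp_div_le h₀ hτ hτ1 le_rfl (Or.inl rfl)).trans ?_
    simp only [pow_zero, mul_one]
    gcongr
    exact le_max_left _ _
  · have hD0 : 0 < D := one_pos.trans_le hD
    have := main (fun m => h ((x + m) / τ)) x (max C₀ C₁ * D ^ N * τ ^ N) (by positivity)
      fun m => by
        refine (norm_comp_div_le h₁ hτ hτ1 hD (Or.inr (hx m))).trans ?_
        gcongr
        exact le_max_right _ _
    linarith
  · have hs : Summable fun m : ℤ => h ((0 + m) / τ) := by
      refine Summable.of_norm_bounded ((summable_and_tsum_translate_le 0).1.mul_left C₀)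
        fun m => ?_
      have := norm_comp_div_le h₀ hτ hτ1 le_rfl (y := 0 + m) (Or.inl rfl)
      simpa using this
    rw [hs.tsum_eq_add_tsum_ite 0]
    simp only [Int.cast_zero, add_zero, zero_div, add_sub_cancel_left]
    have := main (fun m => if m = 0 then 0 else h ((0 + m) / τ)) 0 (max C₀ C₁ * τ ^ N)
      (by positivity) fun m => by
        split_ifs with hm
        · simp only [norm_zero]
          positivity
        · have h1 : (1 : ℝ)⁻¹ ≤ |0 + (m : ℝ)| := by
            rw [inv_one, zero_add]
            exact_mod_cast Int.one_le_abs hm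
          refine (norm_comp_div_le h₁ hτ hτ1 le_rfl (Or.inr h1)).trans ?_
          simp only [one_pow, mul_one]
          gcongr
          exact le_max_right _ _
    linarith

/-! ### The functions `x ^ b * exp (-π x ^ 2)` and their theta series -/

theorem exists_iteratedDeriv_polynomial_mul_gaussian (n : ℕ) :
    ∀ P : Polynomial ℝ, ∃ R : Polynomial ℝ,
      iteratedDeriv n (fun x : ℝ => P.eval x * Real.exp (-π * x ^ 2)) =
        fun x : ℝ => R.eval x * Real.exp (-π * x ^ 2) := by
  induction n with
  | zero => exact fun P => ⟨P, by simp⟩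
  | succ n ih =>
    intro P
    obtain ⟨R, hR⟩ := ih (P.derivative - Polynomial.C (2 * π) * Polynomial.X * P)
    refine ⟨R, ?_⟩
    rw [iteratedDeriv_succ', ← hR]
    congr 1
    ext x
    have h1 : HasDerivAt (fun x : ℝ => Real.exp (-π * x ^ 2))
        (Real.exp (-π * x ^ 2) * (-π * (2 * x))) x := by
      have := ((hasDerivAt_pow 2 x).const_mul (-π)).exp
      simpa using this
    refine ((P.hasDerivAt x).mul h1).deriv.trans ?_
    simp
    ring

theorem exists_abs_polynomial_mul_gaussian_le (P : Polynomial ℝ) :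
    ∃ C : ℝ, ∀ x : ℝ, |P.eval x * Real.exp (-π * x ^ 2)| ≤ C := by
  induction P using Polynomial.induction_on' with
  | add P R hP hR =>
    obtain ⟨C, hC⟩ := hP
    obtain ⟨D, hD⟩ := hR
    refine ⟨C + D, fun x => ?_⟩
    rw [Polynomial.eval_add, add_mul]
    exact (abs_add_le _ _).trans (add_le_add (hC x) (hD x))
  | monomial n c =>
    refine ⟨|c| * (1 + n.factorial), fun x => ?_⟩
    rw [Polynomial.eval_monomial, mul_assoc, abs_mul]
    refine mul_le_mul_of_nonneg_left ?_ (abs_nonneg _)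
    have h0 : 0 ≤ x ^ 2 := sq_nonneg x
    have h1 : Real.exp (-π * x ^ 2) ≤ Real.exp (-x ^ 2) := by
      refine Real.exp_le_exp.mpr ?_
      nlinarith [Real.pi_gt_three]
    have h2 : (x ^ 2) ^ n * Real.exp (-x ^ 2) ≤ n.factorial := by
      have := Real.pow_div_factorial_le_exp (x ^ 2) h0 n
      rw [div_le_iff₀ (by positivity)] at this
      rw [Real.exp_neg, ← div_eq_mul_inv, div_le_iff₀ (Real.exp_pos _)]
      linarith
    have h3 : Real.exp (-x ^ 2) ≤ 1 := Real.exp_le_one_iff.mpr (by linarith)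
    have h4 : |x| ^ n ≤ 1 + (x ^ 2) ^ n := by
      rw [← sq_abs, ← pow_mul, mul_comm 2 n, pow_mul]
      nlinarith [sq_nonneg (|x| ^ n - 1), sq_nonneg (|x| ^ n)]
    rw [abs_mul, abs_pow, abs_of_pos (Real.exp_pos _)]
    calc |x| ^ n * Real.exp (-π * x ^ 2) ≤ (1 + (x ^ 2) ^ n) * Real.exp (-x ^ 2) := by gcongr
      _ ≤ _ := by linarith

/-- The Schwartz function `x ^ b * exp (-π x ^ 2)`. -/
noncomputable def gaussMono (b : ℕ) : 𝓢(ℝ, ℂ) where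
  toFun x := ((x ^ b * Real.exp (-π * x ^ 2) : ℝ) : ℂ)
  smooth' := by
    have : ContDiff ℝ (⊤ : ℕ∞) fun x : ℝ => x ^ b * Real.exp (-π * x ^ 2) := by fun_prop
    exact Complex.ofRealCLM.contDiff.comp this
  decay' k n := by
    obtain ⟨R, hR⟩ := exists_iteratedDeriv_polynomial_mul_gaussian n (Polynomial.X ^ b)
    obtain ⟨C, hC⟩ := exists_abs_polynomial_mul_gaussian_le (Polynomial.X ^ k * R)
    refine ⟨C, fun x => ?_⟩
    have h1 : iteratedFDeriv ℝ n
        (fun x : ℝ => ((x ^ b * Real.exp (-π * x ^ 2) : ℝ) : ℂ)) x =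
        Complex.ofRealCLM.compContinuousMultilinearMap
          (iteratedFDeriv ℝ n (fun x : ℝ => x ^ b * Real.exp (-π * x ^ 2)) x) :=
      Complex.ofRealCLM.iteratedFDeriv_comp_left (f := fun x : ℝ => x ^ b * Real.exp (-π * x ^ 2))
        (n := n) (by fun_prop) le_rfl
    have h2 : ‖iteratedFDeriv ℝ n
        (fun x : ℝ => ((x ^ b * Real.exp (-π * x ^ 2) : ℝ) : ℂ)) x‖ =
        ‖iteratedDeriv n (fun x : ℝ => x ^ b * Real.exp (-π * x ^ 2)) x‖ := by
      rw [← norm_iteratedFDeriv_eq_norm_iteratedDeriv]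
      exact Complex.ofRealLI.norm_iteratedFDeriv_comp_left (f := fun x : ℝ =>
        x ^ b * Real.exp (-π * x ^ 2)) (n := n) (i := n) (x := x) (by fun_prop) le_rfl
    rw [h2]
    simp only [Polynomial.eval_pow, Polynomial.eval_X] at hR
    rw [hR]
    have := hC x
    simp only [Polynomial.eval_mul, Polynomial.eval_pow, Polynomial.eval_X, abs_mul, abs_pow]
      at this
    simp only [Real.norm_eq_abs, abs_mul]
    linarith

theorem gaussMono_apply (b : ℕ) (x : ℝ) :
    gaussMono b x = ((x ^ b * Real.exp (-π * x ^ 2) : ℝ) : ℂ) := rfl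

/-- The term `k ^ b * exp (-π τ ^ 2 k ^ 2) * exp (2 π i k x)` of a one-dimensional theta series. -/
noncomputable def thetaTerm (b : ℕ) (τ x : ℝ) (k : ℤ) : ℂ :=
  (k : ℂ) ^ b * Real.exp (-π * τ ^ 2 * (k : ℝ) ^ 2) * Complex.exp (2 * π * Complex.I * k * x)

theorem pow_mul_thetaTerm (b : ℕ) (τ x : ℝ) (k : ℤ) :
    (τ : ℂ) ^ b * thetaTerm b τ x k =
      gaussMono b (τ * k) * Complex.exp (2 * π * Complex.I * k * x) := by
  rw [gaussMono_apply, thetaTerm]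
  push_cast
  rw [mul_pow, mul_pow]
  ring_nf

theorem norm_exp_two_pi_I_mul (y : ℝ) (k : ℤ) : ‖Complex.exp (2 * π * Complex.I * k * y)‖ = 1 := by
  rw [Complex.norm_exp]
  simp

theorem summable_norm_thetaTerm (b : ℕ) {τ : ℝ} (hτ : 0 < τ) (x : ℝ) :
    Summable fun k => ‖thetaTerm b τ x k‖ := by
  obtain ⟨C, hC⟩ := exists_norm_le_max_one_abs (gaussMono b) hτ
  refine Summable.of_nonneg_of_le (fun _ => norm_nonneg _) (fun k => ?_)
    (((summable_max_one_abs_rpow one_lt_two).mul_left C).mul_left (τ ^ b)⁻¹)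
  rw [le_inv_mul_iff₀ (by positivity)]
  refine le_trans (le_of_eq ?_) (hC k)
  have := congrArg norm (pow_mul_thetaTerm b τ x k)
  rw [norm_mul, norm_mul, norm_exp_two_pi_I_mul, mul_one, norm_pow, Complex.norm_real,
    Real.norm_of_nonneg hτ.le] at this
  exact this

/-- The limit of `τ ^ (b + 1) ∑ k ^ b exp (-π τ ^ 2 k ^ 2)` as `τ → 0`. -/
noncomputable def thetaConst (b : ℕ) : ℝ := ∫ y : ℝ, y ^ b * Real.exp (-π * y ^ 2)

/-- Poisson summation gives the behaviour of theta series as `τ → 0`. -/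
theorem exists_theta_bounds (b N : ℕ) :
    ∃ C : ℝ, 0 ≤ C ∧ ∀ τ : ℝ, 0 < τ → τ ≤ 1 →
      (∀ x : ℝ, ‖(τ : ℂ) ^ (b + 1) * ∑' k, thetaTerm b τ x k‖ ≤ C) ∧
      (∀ x D : ℝ, 1 ≤ D → (∀ m : ℤ, D⁻¹ ≤ |x + m|) →
        ‖(τ : ℂ) ^ (b + 1) * ∑' k, thetaTerm b τ x k‖ ≤ C * D ^ N * τ ^ N) ∧
      ‖(τ : ℂ) ^ (b + 1) * ∑' k, thetaTerm b τ 0 k - thetaConst b‖ ≤ C * τ ^ N := by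
  obtain ⟨C, hC0, hC⟩ := exists_tsum_comp_div_bounds (𝓕⁻ (gaussMono b)) N
  have e : ∀ τ : ℝ, 0 < τ → ∀ x : ℝ, (τ : ℂ) ^ (b + 1) * ∑' k, thetaTerm b τ x k =
      ∑' m : ℤ, (𝓕⁻ (gaussMono b)) ((x + m) / τ) := by
    intro τ hτ x
    rw [tsum_comp_div_eq _ hτ, ← tsum_mul_left]
    refine tsum_congr fun k => ?_
    rw [FourierTransform.fourier_fourierInv_eq, pow_succ', mul_assoc, pow_mul_thetaTerm,
      ← mul_assoc]
  have e0 : (𝓕⁻ (gaussMono b)) 0 = (thetaConst b : ℂ) := by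
    rw [SchwartzMap.fourierInv_coe, Real.fourierInv_eq', thetaConst, ← integral_complex_ofReal]
    simp only [gaussMono_apply]
    simp
  refine ⟨C, hC0, fun τ hτ hτ1 => ?_⟩
  obtain ⟨h1, h2, h3⟩ := hC τ hτ hτ1
  refine ⟨fun x => by rw [e τ hτ]; exact h1 x, fun x D hD hx => by rw [e τ hτ]; exact h2 x D hD hx,
    by rw [e τ hτ, ← e0]; exact h3⟩

/-! ### Moments of the sphere -/

/-- The moment `∫ u ^ β dS(u)` of the unit sphere of `ℝ ^ n`. -/
noncomputable def sphereMoment {n : ℕ} (β : Fin n → ℕ) : ℝ :=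
  ∫ u : Metric.sphere (0 : EuclideanSpace ℝ (Fin n)) 1,
    ∏ t, (u : EuclideanSpace ℝ (Fin n)) t ^ β t
    ∂(MeasureTheory.volume : MeasureTheory.Measure (EuclideanSpace ℝ (Fin n))).toSphere

open MeasureTheory in
theorem integral_volumeIoiPow (m : ℕ) (f : ℝ → ℝ) :
    ∫ x : Set.Ioi (0 : ℝ), f x ∂(Measure.volumeIoiPow m) = ∫ x in Set.Ioi (0 : ℝ), x ^ m * f x := by
  simp only [Measure.volumeIoiPow, ENNReal.ofReal]
  rw [integral_withDensity_eq_integral_smul,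
    integral_subtype_comap measurableSet_Ioi fun a ↦ Real.toNNReal (a ^ m) • f a,
    setIntegral_congr_fun measurableSet_Ioi fun x hx ↦ ?_]
  · rw [NNReal.smul_def, Real.coe_toNNReal _ (pow_nonneg (le_of_lt hx) _), smul_eq_mul]
  · exact (measurable_subtype_coe.pow_const _).real_toNNReal

open MeasureTheory in
/-- The Gaussian integral of a monomial, in polar coordinates. -/
theorem prod_thetaConst_eq {n : ℕ} (hn : 1 ≤ n) (β : Fin n → ℕ) :
    ∏ t, thetaConst (β t) = sphereMoment β *
      (1 / 2 * (π ^ (-(((n : ℝ) + ∑ t, (β t : ℝ)) / 2)) *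
        Real.Gamma (((n : ℝ) + ∑ t, (β t : ℝ)) / 2))) := by
  have : NeZero n := ⟨by omega⟩
  set E := EuclideanSpace ℝ (Fin n)
  set μ : Measure E := volume
  have hdim : Module.finrank ℝ E = n := by simp [E]
  let f : E → ℝ := fun x => ∏ t, (x t ^ β t * Real.exp (-π * x t ^ 2))
  let G : Metric.sphere (0 : E) 1 × Set.Ioi (0 : ℝ) → ℝ := fun z =>
    (∏ t, (z.1 : E) t ^ β t) * ((z.2 : ℝ) ^ (∑ t, β t) * Real.exp (-π * (z.2 : ℝ) ^ 2))
  have hfG : ∀ x : ({0}ᶜ : Set E), G (homeomorphUnitSphereProd E x) = f x := by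
    intro x
    have hx : ‖(x : E)‖ ≠ 0 := norm_ne_zero_iff.mpr x.2
    simp only [G, f, homeomorphUnitSphereProd_apply_fst_coe,
      homeomorphUnitSphereProd_apply_snd_coe]
    rw [Finset.prod_mul_distrib, ← Real.exp_sum, ← Finset.mul_sum, EuclideanSpace.real_norm_sq_eq,
      ← mul_assoc, ← Finset.prod_pow_eq_pow_sum, ← Finset.prod_mul_distrib]
    congr 1
    refine Finset.prod_congr rfl fun t _ => ?_
    rw [← mul_pow]
    congr 1
    change ‖(x : E)‖⁻¹ * (x : E) t * ‖(x : E)‖ = (x : E) t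
    field_simp
  have h1 : ∏ t, thetaConst (β t) = ∫ x, f x ∂μ := by
    have h := (PiLp.volume_preserving_ofLp (Fin n)).integral_comp
      (MeasurableEquiv.toLp 2 (Fin n → ℝ)).symm.measurableEmbedding
      (fun x : Fin n → ℝ => ∏ t, (x t ^ β t * Real.exp (-π * x t ^ 2)))
    rw [integral_fintype_prod_volume_eq_prod
      (fun t (y : ℝ) => y ^ β t * Real.exp (-π * y ^ 2))] at h
    exact h.symm
  have h2 : ∫ x, f x ∂μ = ∫ z, G z ∂(μ.toSphere.prod (Measure.volumeIoiPow (n - 1))) := by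
    calc ∫ x, f x ∂μ = ∫ x : ({(0)}ᶜ : Set E), f x ∂(μ.comap (↑)) := by
          rw [integral_subtype_comap (measurableSet_singleton _).compl f,
            restrict_compl_singleton]
      _ = _ := by
          have h := μ.measurePreserving_homeomorphUnitSphereProd.integral_comp
            (Homeomorph.measurableEmbedding _) G
          rw [hdim] at h
          rw [← h]
          simp only [hfG]
  have h3 : ∫ x in Set.Ioi (0 : ℝ), x ^ (n - 1) * (x ^ (∑ t, β t) * Real.exp (-π * x ^ 2)) =
      1 / 2 * (π ^ (-(((n : ℝ) + ∑ t, (β t : ℝ)) / 2)) *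
        Real.Gamma (((n : ℝ) + ∑ t, (β t : ℝ)) / 2)) := by
    have hq : (-1 : ℝ) < (n : ℝ) + ∑ t, (β t : ℝ) - 1 := by
      have : (1 : ℝ) ≤ n := by exact_mod_cast hn
      have : 0 ≤ ∑ t, (β t : ℝ) := Finset.sum_nonneg fun _ _ => Nat.cast_nonneg _
      linarith
    have h := integral_rpow_mul_exp_neg_mul_rpow (p := 2) two_pos hq Real.pi_pos
    rw [sub_add_cancel, neg_div] at h
    rw [← mul_assoc, mul_comm (1 / 2 : ℝ), ← h]
    refine setIntegral_congr_fun measurableSet_Ioi fun x hx => ?_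
    have e : (n : ℝ) + ∑ t, (β t : ℝ) - 1 = ((n - 1 + ∑ t, β t : ℕ) : ℝ) := by
      push_cast [Nat.cast_sub hn]
      ring
    rw [e, Real.rpow_natCast, pow_add, Real.rpow_two, mul_assoc]
  rw [h1, h2, ← h3, ← integral_volumeIoiPow, sphereMoment]
  exact integral_prod_mul (fun u : Metric.sphere (0 : E) 1 => ∏ t, (u : E) t ^ β t)
    (fun r : Set.Ioi (0 : ℝ) => (r : ℝ) ^ (∑ t, β t) * Real.exp (-π * (r : ℝ) ^ 2))

/-! ### The binomial expansion of the square root -/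

/-- Taylor's formula for `√(1 + x)`, with a remainder estimate on the whole domain `-1 ≤ x`. -/
theorem exists_abs_sqrt_one_add_sub_le {N : ℕ} (hN : 1 ≤ N) :
    ∃ C : ℝ, 0 ≤ C ∧ ∀ x : ℝ,
      |√(1 + x) - ∑ j ∈ Finset.range N, Ring.choose (1 / 2 : ℝ) j * x ^ j| ≤ C * |x| ^ N := by
  set S : ℝ → ℝ := fun x => ∑ j ∈ Finset.range N, Ring.choose (1 / 2 : ℝ) j * x ^ j with hS
  have h := (Real.one_add_rpow_hasFPowerSeriesAt_zero (a := 1 / 2)).isBigO_sub_partialSum_pow N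
  obtain ⟨C₁, hC₁⟩ := h.bound
  obtain ⟨ε, hε, hball⟩ := Metric.eventually_nhds_iff.mp hC₁
  set C₂ : ℝ := ((1 + ε) + ∑ j ∈ Finset.range N, |Ring.choose (1 / 2 : ℝ) j| * ε ^ j) / ε ^ N
  refine ⟨max (max C₁ C₂) 0, le_max_right _ _, fun x => ?_⟩
  rcases lt_or_ge |x| ε with hx | hx
  · have h1 := hball (y := x) (by simpa using hx)
    have h2 : (binomialSeries ℝ (1 / 2 : ℝ)).partialSum N x = S x := by
      simp only [FormalMultilinearSeries.partialSum, hS]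
      refine Finset.sum_congr rfl fun j _ => ?_
      rw [binomialSeries_apply]
      simp
    rw [h2, zero_add, ← Real.sqrt_eq_rpow] at h1
    simp only [norm_pow, Real.norm_eq_abs, abs_abs] at h1
    exact h1.trans (mul_le_mul_of_nonneg_right ((le_max_left _ _).trans (le_max_left _ _))
      (by positivity))
  · have hy : 1 ≤ |x| / ε := (one_le_div hε).mpr hx
    have hxy : |x| = ε * (|x| / ε) := by field_simp
    set y := |x| / ε
    have h1 : |√(1 + x)| ≤ (1 + ε) * y ^ N := by
      have h3 : √(1 + x) ≤ 1 + |x| := by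
        rw [Real.sqrt_le_left (by positivity)]
        nlinarith [abs_nonneg x, le_abs_self x]
      have h4 : y ≤ y ^ N := le_self_pow₀ hy (by omega)
      rw [abs_of_nonneg (Real.sqrt_nonneg _)]
      calc √(1 + x) ≤ 1 + |x| := h3
        _ = 1 + ε * y := by rw [hxy]
        _ ≤ (1 + ε) * y := by linarith
        _ ≤ (1 + ε) * y ^ N := by gcongr
    have h2 : |S x| ≤ (∑ j ∈ Finset.range N, |Ring.choose (1 / 2 : ℝ) j| * ε ^ j) * y ^ N := by
      rw [hS, Finset.sum_mul]
      refine (Finset.abs_sum_le_sum_abs _ _).trans (Finset.sum_le_sum fun j hj => ?_)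
      rw [abs_mul, abs_pow, hxy, mul_pow, mul_assoc]
      have : y ^ j ≤ y ^ N := pow_le_pow_right₀ hy (Finset.mem_range.mp hj).le
      gcongr
    calc |√(1 + x) - S x| ≤ |√(1 + x)| + |S x| := abs_sub _ _
      _ ≤ ((1 + ε) + ∑ j ∈ Finset.range N, |Ring.choose (1 / 2 : ℝ) j| * ε ^ j) * y ^ N := by
          linarith
      _ = C₂ * |x| ^ N := by
          rw [hxy, mul_pow]
          simp only [C₂]
          field_simp
      _ ≤ _ := mul_le_mul_of_nonneg_right ((le_max_right _ _).trans (le_max_left _ _))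
          (by positivity)

/-! ### Mellin transforms of functions with a power asymptotic at zero -/

open MeasureTheory Set Asymptotics Filter in
/-- If `F` decays exponentially at infinity and agrees near `0` with `P * t ^ (-A) - D` up to
`O(t ^ N)` for every `N`, then its Mellin transform continues to the plane with at most the two
poles at `A` and `0`. -/
theorem exists_mellin_continuation {F : ℝ → ℂ} (hF : ContinuousOn F (Ioi 0)) {c A : ℝ} (hc : 0 < c)
    (hA : 0 < A) (htop : F =O[atTop] fun t => Real.exp (-c * t)) (P D : ℂ)
    (hbot : ∀ N : ℕ, (fun t : ℝ => F t - (P * (t : ℂ) ^ (-(A : ℂ)) - D)) =O[𝓝[>] 0]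
      fun t : ℝ => t ^ (N : ℝ)) :
    ∃ M : ℂ → ℂ, Differentiable ℂ M ∧ ∀ s : ℂ, A < s.re →
      mellin F s = M s + P / (s - A) - D / s := by
  -- subtracting the asymptotic on `(0, 1]` only leaves a function whose Mellin transform is entire
  set I₁ : ℝ → ℂ := (Ioc 0 1).indicator fun t : ℝ => (t : ℂ) ^ (-(A : ℂ))
  set I₂ : ℝ → ℂ := (Ioc 0 1).indicator fun _ => 1
  set G : ℝ → ℂ := fun t => F t - P • I₁ t + D • I₂ t
  have hloc : LocallyIntegrableOn G (Ioi 0) := by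
    have h1 : LocallyIntegrableOn (fun t : ℝ => (t : ℂ) ^ (-(A : ℂ))) (Ioi 0) := by
      refine ContinuousOn.locallyIntegrableOn ?_ measurableSet_Ioi
      refine continuousOn_of_forall_continuousAt fun x (hx : 0 < x) => ?_
      exact Complex.continuousAt_ofReal_cpow_const _ _ (Or.inr hx.ne')
    have h2 : LocallyIntegrableOn I₁ (Ioi 0) := fun x hx => by
      obtain ⟨s, hs, hs'⟩ := h1 x hx
      exact ⟨s, hs, hs'.indicator measurableSet_Ioc⟩
    have h3 : LocallyIntegrableOn I₂ (Ioi 0) := fun x hx => by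
      obtain ⟨s, hs, hs'⟩ :=
        locallyIntegrableOn_const (s := Ioi (0 : ℝ)) (μ := volume) (1 : ℂ) x hx
      exact ⟨s, hs, hs'.indicator measurableSet_Ioc⟩
    exact ((hF.locallyIntegrableOn measurableSet_Ioi).sub (h2.smul P)).add (h3.smul D)
  have hGtop : G =O[atTop] fun t => Real.exp (-c * t) := by
    refine htop.congr' ?_ EventuallyEq.rfl
    filter_upwards [eventually_gt_atTop 1] with t ht
    have : t ∉ Ioc (0 : ℝ) 1 := fun h => absurd h.2 (not_le.mpr ht)
    simp [G, I₁, I₂, this]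
  have hGbot : ∀ N : ℕ, G =O[𝓝[>] 0] fun t : ℝ => t ^ (-(-(N : ℝ))) := by
    intro N
    refine (hbot N).congr' ?_ (by simp)
    filter_upwards [Ioc_mem_nhdsGT (zero_lt_one' ℝ)] with t ht
    simp only [G, I₁, I₂, indicator_of_mem ht, smul_eq_mul]
    ring
  have hG : ∀ s : ℂ, MellinConvergent G s ∧ DifferentiableAt ℂ (mellin G) s := by
    intro s
    obtain ⟨N, hN⟩ := exists_nat_gt (-s.re)
    have hs : -(N : ℝ) < s.re := by linarith
    exact ⟨mellinConvergent_of_isBigO_rpow_exp hc hloc hGtop (hGbot N) hs,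
      mellin_differentiableAt_of_isBigO_rpow_exp hc hloc hGtop (hGbot N) hs⟩
  refine ⟨mellin G, fun s => (hG s).2, fun s hs => ?_⟩
  have h1 : HasMellin I₁ s (1 / (s + -(A : ℂ))) :=
    hasMellin_cpow_Ioc (-(A : ℂ)) (by simpa using hs)
  have h2 : HasMellin I₂ s (1 / s) := hasMellin_one_Ioc (hA.trans hs)
  have h3 := hasMellin_const_smul h1.1 P
  have h4 := hasMellin_const_smul h2.1 D
  have h5 := hasMellin_add (hG s).1 h3.1
  have h6 := hasMellin_sub h5.1 h4.1
  have hFG : (fun t => G t + P • I₁ t - D • I₂ t) = F := by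
    ext t
    simp only [G]
    ring
  rw [hFG] at h6
  rw [h6.2, h5.2, h3.2, h4.2, h1.2, h2.2, smul_eq_mul, smul_eq_mul, sub_eq_add_neg s]
  ring

/-! ### Theta series in several variables -/

/-- The monomial `k ^ β`. -/
noncomputable def latMono {n : ℕ} (β : Fin n → ℕ) (k : Fin n → ℤ) : ℂ := ∏ t, (k t : ℂ) ^ β t

/-- The character `exp (2 π i k · x)`. -/
noncomputable def latChar {n : ℕ} (x : Fin n → ℝ) (k : Fin n → ℤ) : ℂ :=
  Complex.exp (2 * π * Complex.I * ((toReal k ⬝ᵥ x : ℝ) : ℂ))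

theorem norm_latChar {n : ℕ} (x : Fin n → ℝ) (k : Fin n → ℤ) : ‖latChar x k‖ = 1 := by
  rw [latChar, Complex.norm_exp]
  simp

theorem norm_latMono_le {n : ℕ} (β : Fin n → ℕ) (k : Fin n → ℤ) :
    ‖latMono β k‖ ≤ vnorm k ^ (∑ t, β t) := by
  rw [latMono, norm_prod, ← Finset.prod_pow_eq_pow_sum]
  refine Finset.prod_le_prod (fun _ _ => norm_nonneg _) fun t _ => ?_
  rw [norm_pow, Complex.norm_intCast]
  exact pow_le_pow_left₀ (abs_nonneg _) (abs_le_vnorm k t) _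

theorem prod_thetaTerm {n : ℕ} (β : Fin n → ℕ) (τ : ℝ) (x : Fin n → ℝ) (k : Fin n → ℤ) :
    ∏ t, thetaTerm (β t) τ (x t) (k t) =
      latMono β k * latChar x k * Real.exp (-(π * vnorm k ^ 2) * τ ^ 2) := by
  simp only [thetaTerm, Finset.prod_mul_distrib]
  rw [latMono, latChar, ← Complex.exp_sum, ← Complex.ofReal_prod, ← Real.exp_sum, vnorm_sq,
    mul_right_comm]
  congr 2
  · congr 1
    simp only [dotProduct, toReal]
    push_cast
    rw [Finset.mul_sum]
    exact Finset.sum_congr rfl fun t _ => by ring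
  · congr 2
    rw [Finset.mul_sum, ← Finset.sum_neg_distrib, Finset.sum_mul]
    exact Finset.sum_congr rfl fun t _ => by ring

theorem summable_norm_prod_thetaTerm {n : ℕ} (β : Fin n → ℕ) {τ : ℝ} (hτ : 0 < τ)
    (x : Fin n → ℝ) :
    (Summable fun k : Fin n → ℤ => ‖∏ t, thetaTerm (β t) τ (x t) (k t)‖) ∧
    ∑' k : Fin n → ℤ, ∏ t, thetaTerm (β t) τ (x t) (k t) =
      ∏ t, ∑' k, thetaTerm (β t) τ (x t) k :=
  summable_norm_and_tsum_prod_pi n (fun t => thetaTerm (β t) τ (x t))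
    fun t => summable_norm_thetaTerm (β t) hτ (x t)

/-- Behaviour of the theta series in `n` variables as `τ → 0`: it tends to zero rapidly if one of
the coordinates of `x` stays away from the integers. -/
theorem exists_prod_theta_bounds {n : ℕ} (β : Fin n → ℕ) (N : ℕ) :
    ∃ C : ℝ, 0 ≤ C ∧ ∀ τ : ℝ, 0 < τ → τ ≤ 1 →
      (∀ (x : Fin n → ℝ) (D : ℝ), 1 ≤ D → (∃ j, ∀ m : ℤ, D⁻¹ ≤ |x j + m|) →
        ‖(τ : ℂ) ^ (n + ∑ t, β t) * ∏ t, ∑' k, thetaTerm (β t) τ (x t) k‖ ≤ C * D ^ N * τ ^ N) ∧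
      ‖(τ : ℂ) ^ (n + ∑ t, β t) * ∏ t, ∑' k, thetaTerm (β t) τ 0 k -
        ((∏ t, thetaConst (β t) : ℝ) : ℂ)‖ ≤ C * τ ^ N := by
  choose C hC0 hC using fun t => exists_theta_bounds (β t) N
  set A : ℝ := 1 + ∑ t, (C t + |thetaConst (β t)|)
  have hle : ∀ t, C t + |thetaConst (β t)| ≤ ∑ t, (C t + |thetaConst (β t)|) := fun t =>
    Finset.single_le_sum (f := fun t => C t + |thetaConst (β t)|)
      (fun t _ => add_nonneg (hC0 t) (abs_nonneg _)) (Finset.mem_univ t)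
  have hCA : ∀ t, C t ≤ A := fun t => by linarith [hle t, abs_nonneg (thetaConst (β t))]
  have hcA : ∀ t, |thetaConst (β t)| ≤ A := fun t => by linarith [hle t, hC0 t]
  have hA : 1 ≤ A := by
    have : 0 ≤ ∑ t, (C t + |thetaConst (β t)|) :=
      Finset.sum_nonneg fun t _ => add_nonneg (hC0 t) (abs_nonneg _)
    linarith
  have hA0 : 0 ≤ A := zero_le_one.trans hA
  have e : ∀ (τ : ℝ) (f : Fin n → ℂ), (τ : ℂ) ^ (n + ∑ t, β t) * ∏ t, f t =
      ∏ t, ((τ : ℂ) ^ (β t + 1) * f t) := by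
    intro τ f
    rw [Finset.prod_mul_distrib, Finset.prod_pow_eq_pow_sum, Finset.sum_add_distrib]
    simp [add_comm]
  refine ⟨A ^ n + n * A ^ n * A, by positivity, fun τ hτ hτ1 => ⟨fun x D hD ⟨j, hj⟩ => ?_, ?_⟩⟩
  · have hD0 : 0 < D := one_pos.trans_le hD
    rw [e, norm_prod, ← Finset.mul_prod_erase _ _ (Finset.mem_univ j)]
    have h1 := ((hC j τ hτ hτ1).2.1 (x j) D hD hj)
    have h2 : ∏ t ∈ Finset.univ.erase j, ‖(τ : ℂ) ^ (β t + 1) * ∑' k, thetaTerm (β t) τ (x t) k‖ ≤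
        A ^ (n - 1) := by
      refine (Finset.prod_le_prod (fun _ _ => norm_nonneg _)
        fun t _ => ((hC t τ hτ hτ1).1 (x t)).trans (hCA t)).trans ?_
      simp
    calc _ ≤ (C j * D ^ N * τ ^ N) * A ^ (n - 1) := by
          have := hC0 j
          gcongr
      _ ≤ (A * D ^ N * τ ^ N) * A ^ (n - 1) := by
          gcongr
          exact hCA j
      _ = A ^ n * D ^ N * τ ^ N := by
          rw [← mul_pow_sub_one (Fin.pos j).ne' A]
          ring
      _ ≤ _ := by
          gcongr
          have : 0 ≤ n * A ^ n * A := by positivity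
          linarith
  · rw [e, Complex.ofReal_prod]
    have := norm_prod_sub_prod_le_of_le (ε := A * τ ^ N) Finset.univ
      (fun t => (τ : ℂ) ^ (β t + 1) * ∑' k, thetaTerm (β t) τ 0 k)
      (fun t => (thetaConst (β t) : ℂ)) hA
      (fun t _ => ((hC t τ hτ hτ1).1 0).trans (hCA t))
      (fun t _ => by simpa using hcA t)
      (fun t _ => ((hC t τ hτ hτ1).2.2).trans (by gcongr; exact hCA t))
    refine this.trans ?_
    simp only [Finset.card_univ, Fintype.card_fin]
    have : 0 ≤ A ^ n * τ ^ N := by positivity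
    linarith

/-! ### Dirichlet series attached to monomials and characters -/

section Continuation

variable {n : ℕ} {ι : Type*}

/-- The theta series `∑ b_l ∑_{k ≠ 0} k ^ β exp (2 π i k · x_l) exp (-π |k| ^ 2 t)`. -/
noncomputable def puncturedTheta (b : ι → ℂ) (x : ι → Fin n → ℝ) (β : Fin n → ℕ) (t : ℝ) : ℂ :=
  ∑' i : ι × {k : Fin n → ℤ // k ≠ 0},
    b i.1 * (latMono β i.2.1 * latChar (x i.1) i.2.1) * Real.exp (-(π * vnorm i.2.1 ^ 2) * t)

theorem summable_norm_latMono_mul_exp (β : Fin n → ℕ) {t : ℝ} (ht : 0 < t) :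
    Summable fun k : Fin n → ℤ => ‖latMono β k‖ * Real.exp (-(π * vnorm k ^ 2) * t) := by
  refine (summable_norm_prod_thetaTerm β (Real.sqrt_pos.mpr ht) 0).1.congr fun k => ?_
  rw [prod_thetaTerm, norm_mul, norm_mul, norm_latChar, mul_one, Complex.norm_real,
    Real.sq_sqrt ht.le, Real.norm_of_nonneg (Real.exp_pos _).le]

theorem norm_puncturedTheta_term (b : ι → ℂ) (x : ι → Fin n → ℝ) (β : Fin n → ℕ) (t : ℝ)
    (i : ι × {k : Fin n → ℤ // k ≠ 0}) :
    ‖b i.1 * (latMono β i.2.1 * latChar (x i.1) i.2.1) *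
      (Real.exp (-(π * vnorm i.2.1 ^ 2) * t) : ℂ)‖ =
      ‖b i.1‖ * (‖latMono β i.2.1‖ * Real.exp (-(π * vnorm i.2.1 ^ 2) * t)) := by
  rw [norm_mul, norm_mul, norm_mul, norm_latChar, mul_one, Complex.norm_real,
    Real.norm_of_nonneg (Real.exp_pos _).le, mul_assoc]

theorem summable_puncturedTheta_bound {b : ι → ℂ} (hb : Summable fun l => ‖b l‖)
    (β : Fin n → ℕ) {t : ℝ} (ht : 0 < t) :
    Summable fun i : ι × {k : Fin n → ℤ // k ≠ 0} =>
      ‖b i.1‖ * (‖latMono β i.2.1‖ * Real.exp (-(π * vnorm i.2.1 ^ 2) * t)) :=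
  hb.mul_of_nonneg ((summable_norm_latMono_mul_exp β ht).comp_injective Subtype.val_injective)
    (fun _ => norm_nonneg _) (fun _ => mul_nonneg (norm_nonneg _) (Real.exp_pos _).le)

theorem summable_puncturedTheta {b : ι → ℂ} (hb : Summable fun l => ‖b l‖)
    (x : ι → Fin n → ℝ) (β : Fin n → ℕ) {t : ℝ} (ht : 0 < t) :
    Summable fun i : ι × {k : Fin n → ℤ // k ≠ 0} =>
      b i.1 * (latMono β i.2.1 * latChar (x i.1) i.2.1) *
        (Real.exp (-(π * vnorm i.2.1 ^ 2) * t) : ℂ) := by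
  refine Summable.of_norm ((summable_puncturedTheta_bound hb β ht).congr fun i => ?_)
  rw [norm_puncturedTheta_term]

theorem continuousOn_puncturedTheta {b : ι → ℂ} (hb : Summable fun l => ‖b l‖)
    (x : ι → Fin n → ℝ) (β : Fin n → ℕ) :
    ContinuousOn (puncturedTheta b x β) (Set.Ioi 0) := by
  refine continuousOn_of_forall_continuousAt fun t₀ (ht₀ : 0 < t₀) => ?_
  have h : ContinuousOn (puncturedTheta b x β) (Set.Ici (t₀ / 2)) := by
    refine continuousOn_tsum (fun i => by fun_prop)
      (summable_puncturedTheta_bound hb β (half_pos ht₀)) fun i t ht => ?_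
    rw [norm_puncturedTheta_term]
    have : -(π * vnorm i.2.1 ^ 2) * t ≤ -(π * vnorm i.2.1 ^ 2) * (t₀ / 2) := by
      have := mul_le_mul_of_nonneg_left (Set.mem_Ici.mp ht)
        (by positivity : 0 ≤ π * vnorm i.2.1 ^ 2)
      linarith
    gcongr
  exact h.continuousAt (Ici_mem_nhds (half_lt_self ht₀))

open Asymptotics Filter in
theorem puncturedTheta_isBigO_atTop {b : ι → ℂ} (hb : Summable fun l => ‖b l‖)
    (x : ι → Fin n → ℝ) (β : Fin n → ℕ) :
    puncturedTheta b x β =O[atTop] fun t => Real.exp (-π * t) := by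
  set S := ∑' i : ι × {k : Fin n → ℤ // k ≠ 0},
    ‖b i.1‖ * (‖latMono β i.2.1‖ * Real.exp (-(π * vnorm i.2.1 ^ 2) * 1))
  refine IsBigO.of_bound (S * Real.exp π) ?_
  filter_upwards [eventually_ge_atTop 1] with t ht
  rw [Real.norm_of_nonneg (Real.exp_pos _).le]
  have hs := (summable_puncturedTheta_bound hb β one_pos).mul_right (Real.exp (-π * (t - 1)))
  refine (tsum_of_norm_bounded hs.hasSum fun i => ?_).trans_eq ?_
  · rw [norm_puncturedTheta_term, mul_assoc, mul_assoc, ← Real.exp_add]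
    have hk := one_le_vnorm i.2.2
    have : -(π * vnorm i.2.1 ^ 2) * t ≤ -(π * vnorm i.2.1 ^ 2) * 1 + -π * (t - 1) := by
      have h1 : 1 ≤ vnorm i.2.1 ^ 2 := one_le_pow₀ hk
      have h2 : 0 ≤ π * (t - 1) := mul_nonneg Real.pi_pos.le (by linarith)
      nlinarith [mul_le_mul_of_nonneg_right h1 h2]
    gcongr
  · rw [tsum_mul_right, mul_assoc, ← Real.exp_add]
    congr 2
    ring

theorem vnorm_zero : vnorm (0 : Fin n → ℤ) = 0 := by simp [vnorm]

/-- Adding the term `k = 0`, the sum over `k` becomes a product of one-dimensional theta series. -/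
theorem puncturedTheta_eq {b : ι → ℂ} (hb : Summable fun l => ‖b l‖)
    (x : ι → Fin n → ℝ) (β : Fin n → ℕ) {τ : ℝ} (hτ : 0 < τ) :
    puncturedTheta b x β (τ ^ 2) =
      ∑' l, b l * (∏ t, (∑' k, thetaTerm (β t) τ (x l t) k) - latMono β 0) := by
  rw [puncturedTheta, (summable_puncturedTheta hb x β (by positivity)).tsum_prod]
  refine tsum_congr fun l => ?_
  obtain ⟨h1, h2⟩ := summable_norm_prod_thetaTerm β hτ (x l)
  have h3 : Summable fun k : Fin n → ℤ => ∏ t, thetaTerm (β t) τ (x l t) (k t) := h1.of_norm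
  rw [← h2, h3.tsum_eq_add_tsum_ite 0]
  have h4 : ∏ t, thetaTerm (β t) τ (x l t) ((0 : Fin n → ℤ) t) = latMono β 0 := by
    rw [prod_thetaTerm, vnorm_zero]
    have : toReal (0 : Fin n → ℤ) = 0 := by ext; simp [toReal]
    simp [latChar, this]
  rw [h4, add_sub_cancel_left]
  simp only [mul_assoc (b l)]
  rw [tsum_mul_left]
  congr 1
  rw [← tsum_subtype_eq_of_support_subset (s := {k : Fin n → ℤ | k ≠ 0})]
  · refine tsum_congr fun k => ?_
    rw [if_neg k.2, prod_thetaTerm]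
  · intro k hk
    by_contra h
    simp only [Set.mem_ofPred_eq, not_not] at h
    simp [h] at hk

open Asymptotics Filter in
/-- The behaviour of `puncturedTheta` near `0`: only the `l` with `x_l = 0` contribute to the
leading term, and the constant term comes from the omitted `k = 0`. -/
theorem puncturedTheta_isBigO_zero {b : ι → ℂ} {W : ι → ℝ} (hW : ∀ l, 1 ≤ W l)
    (hb : ∀ N : ℕ, Summable fun l => ‖b l‖ * W l ^ N) {x : ι → Fin n → ℝ} {Z : Set ι}
    (hZ : ∀ l ∈ Z, x l = 0) (hZ' : ∀ l ∉ Z, ∃ j, ∀ m : ℤ, (W l)⁻¹ ≤ |x l j + m|)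
    (β : Fin n → ℕ) (N : ℕ) :
    (fun t : ℝ => puncturedTheta b x β t -
      (((∏ t, thetaConst (β t) : ℝ) : ℂ) * (∑' l : Z, b l) *
        (t : ℂ) ^ (-((((n + ∑ t, β t : ℕ) : ℝ) / 2 : ℝ) : ℂ)) - latMono β 0 * ∑' l, b l))
      =O[𝓝[>] 0] fun t : ℝ => t ^ (N : ℝ) := by
  classical
  set d := n + ∑ t, β t with hd
  set P : ℂ := ((∏ t, thetaConst (β t) : ℝ) : ℂ)
  have hb0 : Summable fun l => ‖b l‖ := by simpa using hb 0
  -- of the order `d + 2 * N`, the power `τ ^ d` is lost to the normalisation of the theta series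
  obtain ⟨C, hC0, hC⟩ := exists_prod_theta_bounds β (d + 2 * N)
  refine IsBigO.of_bound (∑' l, C * (‖b l‖ * W l ^ (d + 2 * N))) ?_
  filter_upwards [Ioc_mem_nhdsGT (zero_lt_one' ℝ)] with t ht
  obtain ⟨τ, hτ, hτ1, rfl⟩ : ∃ τ : ℝ, 0 < τ ∧ τ ≤ 1 ∧ t = τ ^ 2 :=
    ⟨√t, Real.sqrt_pos.mpr ht.1, Real.sqrt_le_one.mpr ht.2, (Real.sq_sqrt ht.1.le).symm⟩
  have hτc : (τ : ℂ) ≠ 0 := by exact_mod_cast hτ.ne'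
  have hpow : ((τ ^ 2 : ℝ) : ℂ) ^ (-(((d : ℝ) / 2 : ℝ) : ℂ)) = ((τ : ℂ) ^ d)⁻¹ := by
    rw [← Complex.ofReal_neg, ← Complex.ofReal_cpow (by positivity), ← Real.rpow_natCast τ 2,
      ← Real.rpow_mul hτ.le]
    have : ((2 : ℕ) : ℝ) * -((d : ℝ) / 2) = -(d : ℝ) := by push_cast; ring
    rw [this, Real.rpow_neg hτ.le, Real.rpow_natCast]
    push_cast
    rfl
  obtain ⟨hC1, hC2⟩ := hC τ hτ hτ1
  have hterm : ∀ l, ‖∏ t, (∑' k, thetaTerm (β t) τ (x l t) k) -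
      (if l ∈ Z then P * ((τ : ℂ) ^ d)⁻¹ else 0)‖ ≤ C * W l ^ (d + 2 * N) * (τ ^ 2) ^ N := by
    intro l
    have hW0 : 0 < W l := one_pos.trans_le (hW l)
    have e : ∏ t, (∑' k, thetaTerm (β t) τ (x l t) k) - (if l ∈ Z then P * ((τ : ℂ) ^ d)⁻¹ else 0) =
        ((τ : ℂ) ^ d)⁻¹ * ((τ : ℂ) ^ d * ∏ t, (∑' k, thetaTerm (β t) τ (x l t) k) -
          if l ∈ Z then P else 0) := by
      rw [mul_sub, inv_mul_cancel_left₀ (pow_ne_zero _ hτc)]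
      split_ifs <;> ring
    rw [e, norm_mul, norm_inv, norm_pow, Complex.norm_real, Real.norm_of_nonneg hτ.le,
      inv_mul_le_iff₀ (by positivity)]
    have key : ‖(τ : ℂ) ^ d * ∏ t, (∑' k, thetaTerm (β t) τ (x l t) k) - if l ∈ Z then P else 0‖ ≤
        C * W l ^ (d + 2 * N) * τ ^ (d + 2 * N) := by
      split_ifs with hl
      · rw [hZ l hl]
        refine hC2.trans ?_
        have : C ≤ C * W l ^ (d + 2 * N) := le_mul_of_one_le_right hC0 (one_le_pow₀ (hW l))
        gcongr
      · rw [sub_zero]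
        exact hC1 (x l) (W l) (hW l) (hZ' l hl)
    refine key.trans_eq ?_
    rw [pow_add τ, pow_mul τ]
    ring
  have hs1 : Summable fun l => b l * (∏ t, (∑' k, thetaTerm (β t) τ (x l t) k) - latMono β 0) := by
    refine Summable.of_norm_bounded (g := fun l => C * (‖b l‖ * W l ^ (d + 2 * N)) * (τ ^ 2) ^ N +
      ‖b l‖ * (‖P * ((τ : ℂ) ^ d)⁻¹‖ + ‖latMono β 0‖))
      ((((hb _).mul_left C).mul_right _).add (hb0.mul_right _)) fun l => ?_
    rw [norm_mul]
    have h1 : ‖∏ t, (∑' k, thetaTerm (β t) τ (x l t) k) - latMono β 0‖ ≤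
        C * W l ^ (d + 2 * N) * (τ ^ 2) ^ N + (‖P * ((τ : ℂ) ^ d)⁻¹‖ + ‖latMono β 0‖) := by
      have h2 : ‖(if l ∈ Z then P * ((τ : ℂ) ^ d)⁻¹ else 0)‖ ≤ ‖P * ((τ : ℂ) ^ d)⁻¹‖ := by
        split_ifs
        · exact le_rfl
        · rw [norm_zero]
          exact norm_nonneg _
      have h3 := norm_sub_norm_le (∏ t, (∑' k, thetaTerm (β t) τ (x l t) k))
        (if l ∈ Z then P * ((τ : ℂ) ^ d)⁻¹ else 0)
      have h4 := norm_sub_le (∏ t, (∑' k, thetaTerm (β t) τ (x l t) k)) (latMono β 0)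
      linarith [hterm l]
    calc _ ≤ ‖b l‖ * _ := mul_le_mul_of_nonneg_left h1 (norm_nonneg _)
      _ = _ := by ring
  have hs2 : Summable fun l => Z.indicator b l := (Summable.of_norm hb0).indicator Z
  have e : puncturedTheta b x β (τ ^ 2) -
      (P * (∑' l : Z, b l) * ((τ : ℂ) ^ d)⁻¹ - latMono β 0 * ∑' l, b l) =
      ∑' l, b l * (∏ t, (∑' k, thetaTerm (β t) τ (x l t) k) -
        (if l ∈ Z then P * ((τ : ℂ) ^ d)⁻¹ else 0)) := by
    rw [puncturedTheta_eq hb0 x β hτ, tsum_subtype Z b, mul_right_comm, ← tsum_mul_left,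
      ← tsum_mul_left, ← (hs2.mul_left _).tsum_sub ((Summable.of_norm hb0).mul_left _),
      ← hs1.tsum_sub ((hs2.mul_left _).sub ((Summable.of_norm hb0).mul_left _))]
    refine tsum_congr fun l => ?_
    by_cases hl : l ∈ Z
    · rw [Set.indicator_of_mem hl, if_pos hl]
      ring
    · rw [Set.indicator_of_notMem hl, if_neg hl]
      ring
  rw [hpow, e, Real.rpow_natCast, Real.norm_of_nonneg (by positivity), ← tsum_mul_right]
  refine tsum_of_norm_bounded (((hb _).mul_left C).mul_right _).hasSum fun l => ?_
  rw [norm_mul]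
  refine (mul_le_mul_of_nonneg_left (hterm l) (norm_nonneg _)).trans_eq ?_
  ring

/-- The Dirichlet series `∑ b_l ∑_{k ≠ 0} k ^ β exp (2 π i k · x_l) |k| ^ (-s)`, for rapidly
decreasing `b`, has a continuation with at most one pole, which is simple, at `n + |β|`. The residue
only involves the `l` with `x_l = 0`; the other `x_l` have to be separated from `ℤ ^ n`, at a
polynomial rate. -/
theorem exists_entire_continuation (hn : 1 ≤ n) [Countable ι] {b : ι → ℂ} {W : ι → ℝ}
    (hW : ∀ l, 1 ≤ W l)
    (hb : ∀ N : ℕ, Summable fun l => ‖b l‖ * W l ^ N) {x : ι → Fin n → ℝ} {Z : Set ι}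
    (hZ : ∀ l ∈ Z, x l = 0) (hZ' : ∀ l ∉ Z, ∃ j, ∀ m : ℤ, (W l)⁻¹ ≤ |x l j + m|)
    (β : Fin n → ℕ) :
    ∃ E : ℂ → ℂ, Differentiable ℂ E ∧ ∀ s : ℂ, ((n + ∑ t, β t : ℕ) : ℝ) < s.re →
      HasSum (fun i : ι × {k : Fin n → ℤ // k ≠ 0} =>
        b i.1 * (latMono β i.2.1 * latChar (x i.1) i.2.1) * (vnorm i.2.1 : ℂ) ^ (-s))
        (E s + (∑' l : Z, b l) * sphereMoment β / (s - ((n + ∑ t, β t : ℕ) : ℂ))) := by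
  have hb0 : Summable fun l => ‖b l‖ := by simpa using hb 0
  set d := n + ∑ t, β t with hd
  have hd1 : 1 ≤ d := by omega
  have hd0 : (0 : ℝ) < d := by exact_mod_cast hd1
  set B : ℂ := ∑' l : Z, b l
  set P : ℂ := ((∏ t, thetaConst (β t) : ℝ) : ℂ) * B
  set D : ℂ := latMono β 0 * ∑' l, b l
  obtain ⟨M, hM, hMs⟩ := exists_mellin_continuation (continuousOn_puncturedTheta hb0 x β)
    Real.pi_pos (half_pos hd0) (puncturedTheta_isBigO_atTop hb0 x β) P D
    (puncturedTheta_isBigO_zero hW hb hZ hZ' β)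
  have hP : 2 * P * (Complex.Gammaℝ d)⁻¹ = B * sphereMoment β := by
    have h1 := prod_thetaConst_eq hn β
    have e1 : (n : ℝ) + ∑ t, (β t : ℝ) = d := by simp [hd]
    rw [e1] at h1
    have e2 : Complex.Gammaℝ d = ((π ^ (-((d : ℝ) / 2)) * Real.Gamma ((d : ℝ) / 2) : ℝ) : ℂ) := by
      rw [Complex.Gammaℝ_def, Complex.ofReal_mul, ← Complex.Gamma_ofReal,
        Complex.ofReal_cpow Real.pi_pos.le]
      push_cast
      rw [neg_div]
    have e3 : (Complex.Gammaℝ d) ≠ 0 :=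
      Complex.Gammaℝ_ne_zero_of_re_pos (by simpa using hd0)
    simp only [P]
    rw [h1, Complex.ofReal_mul, Complex.ofReal_mul, ← e2]
    field_simp
    push_cast
    ring
  have hGd : Differentiable ℂ fun s => (Complex.Gammaℝ s)⁻¹ := Complex.differentiable_Gammaℝ_inv
  refine ⟨fun s => (Complex.Gammaℝ s)⁻¹ * M (s / 2) - D * ((π : ℂ)⁻¹ * (Complex.Gammaℝ (s + 2))⁻¹) +
    2 * P * dslope (fun s => (Complex.Gammaℝ s)⁻¹) d s, ?_, fun s hs => ?_⟩
  · refine ((hGd.mul (hM.comp (differentiable_id.div_const _))).sub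
      (((hGd.comp (differentiable_id.add_const _)).const_mul _).const_mul _)).add
      (Differentiable.const_mul ?_ _)
    rw [← differentiableOn_univ, Complex.differentiableOn_dslope Filter.univ_mem]
    exact hGd.differentiableOn
  · have hs0 : 0 < s.re := hd0.trans hs
    have hsd : s ≠ d := fun h => by rw [h] at hs; simp at hs
    have hs00 : s ≠ 0 := fun h => by rw [h] at hs0; simp at hs0
    have hG0 : Complex.Gammaℝ s ≠ 0 := Complex.Gammaℝ_ne_zero_of_re_pos hs0
    have hs2 : (s / 2).re = s.re / 2 := by
      rw [show (2 : ℂ) = ((2 : ℝ) : ℂ) by norm_num, Complex.div_ofReal_re]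
    have h1 := hasSum_mellin (a := fun i : ι × {k : Fin n → ℤ // k ≠ 0} =>
        b i.1 * (latMono β i.2.1 * latChar (x i.1) i.2.1))
      (p := fun i => π * vnorm i.2.1 ^ 2) (F := puncturedTheta b x β) (s := s / 2)
      (fun i => Or.inr (by
        have := one_le_vnorm i.2.2
        positivity)) (by rw [hs2]; linarith)
      (fun t ht => (summable_puncturedTheta hb0 x β ht).hasSum) (by
        have hsum := hb0.mul_of_nonneg (summable_vnorm_rpow (n := n) (r := s.re - ∑ t, β t) (by
          have : (d : ℝ) = n + ∑ t, β t := by rw [hd]; push_cast; ring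
          push_cast at this
          push_cast
          linarith)) (fun _ => norm_nonneg _) (fun _ => Real.rpow_nonneg (vnorm_nonneg _) _)
        refine Summable.of_nonneg_of_le (fun i => by
          have := vnorm_nonneg i.2.1
          positivity) (fun i => ?_) (hsum.mul_right ((π ^ (s.re / 2))⁻¹))
        have hk := one_le_vnorm i.2.2
        have hk0 : 0 < vnorm i.2.1 := one_pos.trans_le hk
        rw [norm_mul, norm_mul, norm_latChar, mul_one, hs2,
          Real.mul_rpow Real.pi_pos.le (sq_nonneg _),
          ← Real.rpow_natCast (vnorm i.2.1) 2, ← Real.rpow_mul hk0.le, mul_div_assoc, mul_assoc]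
        refine mul_le_mul_of_nonneg_left ?_ (norm_nonneg _)
        have e : ((2 : ℕ) : ℝ) * (s.re / 2) = s.re := by push_cast; ring
        rw [e, neg_sub, Real.rpow_sub hk0, Real.rpow_natCast, div_mul_eq_div_div_swap,
          ← div_eq_mul_inv]
        gcongr
        exact norm_latMono_le β _)
    rw [hMs _ (by rw [hs2]; linarith)] at h1
    have h2 := h1.mul_left (Complex.Gammaℝ s)⁻¹
    convert! h2 using 1
    · ext i
      have hk := one_le_vnorm i.2.2
      have hk0 : 0 < vnorm i.2.1 := one_pos.trans_le hk
      have hG1 : Complex.Gamma (s / 2) ≠ 0 := by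
        refine Complex.Gamma_ne_zero_of_re_pos ?_
        rw [hs2]
        linarith
      have e1 : ((π * vnorm i.2.1 ^ 2 : ℝ) : ℂ) ^ (s / 2) =
          (π : ℂ) ^ (s / 2) * (vnorm i.2.1 : ℂ) ^ s := by
        rw [Complex.ofReal_mul, Complex.mul_cpow_ofReal_nonneg Real.pi_pos.le (sq_nonneg _),
          Complex.ofReal_pow, ← Complex.cpow_nat_mul' ?_ ?_]
        · congr 2
          push_cast
          ring
        · rw [Complex.arg_ofReal_of_nonneg hk0.le, mul_zero]
          exact neg_lt_zero.mpr Real.pi_pos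
        · rw [Complex.arg_ofReal_of_nonneg hk0.le, mul_zero]
          exact Real.pi_pos.le
      rw [e1, Complex.Gammaℝ_def, Complex.cpow_neg, neg_div, Complex.cpow_neg]
      have e2 : (π : ℂ) ^ (s / 2) ≠ 0 := by
        rw [Complex.cpow_ne_zero_iff]
        exact Or.inl (by exact_mod_cast Real.pi_ne_zero)
      have e3 : (vnorm i.2.1 : ℂ) ^ s ≠ 0 := by
        rw [Complex.cpow_ne_zero_iff]
        exact Or.inl (by exact_mod_cast hk0.ne')
      field_simp
    · beta_reduce
      rw [dslope_of_ne _ hsd, slope_def_field, Complex.Gammaℝ_add_two hs00, ← hP]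
      have hpi : (π : ℂ) ≠ 0 := by exact_mod_cast Real.pi_ne_zero
      have hsd' : s - d ≠ 0 := sub_ne_zero.mpr hsd
      have hsd2 : s / 2 - (((d : ℝ) / 2 : ℝ) : ℂ) = (s - d) / 2 := by push_cast; ring
      have e3 : (Complex.Gammaℝ d) ≠ 0 :=
        Complex.Gammaℝ_ne_zero_of_re_pos (by simpa using hd0)
      rw [hsd2]
      field_simp
      ring

end Continuation

/-! ### Expansion of the factors `|k + l̃_i|` in powers of `|k|` -/

section Expansion

variable {n q : ℕ}

/-- The quantity `(2⟨k, t⟩ + |t|^2) / |k|^2`, for which `|k + t| = |k| * √(1 + ·)`. -/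
noncomputable def sqrtArg (k t : Fin n → ℤ) : ℝ :=
  (2 * ∑ i, (k i : ℝ) * t i + ∑ i, (t i : ℝ) ^ 2) / vnorm k ^ 2

theorem vnorm_add_eq {k : Fin n → ℤ} (hk : k ≠ 0) (t : Fin n → ℤ) :
    vnorm (k + t) = vnorm k * √(1 + sqrtArg k t) := by
  have hk0 : 0 < vnorm k := one_pos.trans_le (one_le_vnorm hk)
  have h : vnorm (k + t) ^ 2 = vnorm k ^ 2 * (1 + sqrtArg k t) := by
    rw [sqrtArg, mul_add, mul_one, mul_div_cancel₀ _ (by positivity), vnorm_sq, vnorm_sq,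
      Finset.mul_sum, ← Finset.sum_add_distrib, ← Finset.sum_add_distrib]
    refine Finset.sum_congr rfl fun i _ => ?_
    simp only [Pi.add_apply, Int.cast_add]
    ring
  rw [← Real.sqrt_sq (vnorm_nonneg (k + t)), h, Real.sqrt_mul (sq_nonneg _),
    Real.sqrt_sq (vnorm_nonneg k)]

theorem abs_sqrtArg_le {k : Fin n → ℤ} (hk : k ≠ 0) (t : Fin n → ℤ) :
    |sqrtArg k t| ≤ (1 + vnorm t) ^ 2 / vnorm k := by
  have hk1 := one_le_vnorm hk
  have hk0 : 0 < vnorm k := one_pos.trans_le hk1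
  have ht := vnorm_nonneg t
  have hcs : |∑ i, (k i : ℝ) * t i| ≤ vnorm k * vnorm t := by
    refine abs_le_of_sq_le_sq ?_ (by positivity)
    rw [mul_pow, vnorm_sq, vnorm_sq]
    exact Finset.sum_mul_sq_le_sq_mul_sq _ _ _
  rw [sqrtArg, abs_div, abs_of_pos (pow_pos hk0 2), ← vnorm_sq, div_le_div_iff₀ (by positivity) hk0]
  have h1 : |2 * ∑ i, (k i : ℝ) * t i + vnorm t ^ 2| ≤ 2 * (vnorm k * vnorm t) + vnorm t ^ 2 := by
    refine (abs_add_le _ _).trans ?_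
    rw [abs_mul, abs_two, abs_of_nonneg (sq_nonneg (vnorm t))]
    linarith
  calc _ ≤ (2 * (vnorm k * vnorm t) + vnorm t ^ 2) * vnorm k := by gcongr
    _ ≤ (2 * (vnorm k * vnorm t) + vnorm k * vnorm t ^ 2) * vnorm k := by
        gcongr
        exact le_mul_of_one_le_left (sq_nonneg _) hk1
    _ = (2 * vnorm t + vnorm t ^ 2) * vnorm k ^ 2 := by ring
    _ ≤ _ := by
        gcongr
        nlinarith

theorem abs_coord_le_latWeight (l : Lat n q) (e : Fin 2) (j : Fin q) (t : Fin n) :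
    |(l e j t : ℝ)| ≤ latWeight l :=
  (abs_le_vnorm _ _).trans (vnorm_le_latWeight l e j)

theorem vnorm_tildeVec_le (l : Lat n q) (i : Fin (q - 1)) :
    vnorm (tildeVec l i) ≤ n * (2 * q) * latWeight l := by
  refine (vnorm_le_sum_abs _).trans ?_
  calc ∑ t, |(tildeVec l i t : ℝ)| ≤ ∑ _t : Fin n, 2 * q * latWeight l := by
        refine Finset.sum_le_sum fun t _ => ?_
        simp only [tildeVec, Finset.sum_apply, Pi.add_apply]
        push_cast
        refine (Finset.abs_sum_le_sum_abs _ _).trans ?_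
        calc _ ≤ ∑ j : Fin q with j.val ≤ i.val, 2 * latWeight l := by
              refine Finset.sum_le_sum fun j _ => (abs_add_le _ _).trans ?_
              linarith [abs_coord_le_latWeight l 0 j t, abs_coord_le_latWeight l 1 j t]
          _ ≤ ∑ j : Fin q, 2 * latWeight l :=
              Finset.sum_le_sum_of_subset_of_nonneg (Finset.filter_subset _ _)
                fun _ _ _ => by linarith [one_le_latWeight l]
          _ = _ := by simp; ring
    _ = _ := by simp; ring

theorem vnorm_firstSum_le (l : Lat n q) : vnorm (firstSum l) ≤ n * q * latWeight l := by
  refine (vnorm_le_sum_abs _).trans ?_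
  calc ∑ t, |(firstSum l t : ℝ)| ≤ ∑ _t : Fin n, q * latWeight l := by
        refine Finset.sum_le_sum fun t _ => ?_
        simp only [firstSum, Finset.sum_apply]
        push_cast
        refine (Finset.abs_sum_le_sum_abs _ _).trans ?_
        calc _ ≤ ∑ j : Fin q, latWeight l :=
              Finset.sum_le_sum fun j _ => abs_coord_le_latWeight l 0 j t
          _ = _ := by simp
    _ = _ := by simp; ring

variable (p : Fin (q - 1) → ℕ)

/-- The product of the truncated expansions of the factors `√(1 + ·)`. -/
noncomputable def truncProd (N : ℕ) (l : Lat n q) (k : Fin n → ℤ) : ℝ :=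
  ∏ i, ∏ _j : Fin (p i),
    ∑ a ∈ Finset.range N, Ring.choose (1 / 2 : ℝ) a * sqrtArg k (tildeVec l i) ^ a

theorem prod_vnorm_add_eq {k : Fin n → ℤ} (hk : k ≠ 0) (l : Lat n q) :
    ∏ i, vnorm (k + tildeVec l i) ^ p i =
      vnorm k ^ (∑ i, p i) * ∏ i, ∏ _j : Fin (p i), √(1 + sqrtArg k (tildeVec l i)) := by
  rw [← Finset.prod_pow_eq_pow_sum, ← Finset.prod_mul_distrib]
  refine Finset.prod_congr rfl fun i _ => ?_
  rw [vnorm_add_eq hk, mul_pow, Finset.prod_const, Finset.card_univ, Fintype.card_fin]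

/-- Truncating the expansions at order `N` gains a factor `|k| ^ (-N)`, uniformly in `l` up to a
power of the weight. -/
theorem exists_abs_prod_sub_truncProd_le {N : ℕ} (hN : 1 ≤ N) :
    ∃ (C : ℝ) (M : ℕ), 0 ≤ C ∧ ∀ (l : Lat n q) (k : Fin n → ℤ), k ≠ 0 →
      |∏ i, vnorm (k + tildeVec l i) ^ p i - vnorm k ^ (∑ i, p i) * truncProd p N l k| ≤
        C * latWeight l ^ M * (vnorm k ^ (∑ i, p i) / vnorm k ^ N) := by
  obtain ⟨C, hC0, hC⟩ := exists_abs_sqrt_one_add_sub_le hN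
  set P := ∑ i, p i with hP
  -- `c * latWeight l` bounds all `1 + |l̃_i|`
  set c : ℝ := 1 + n * (2 * q) with hc
  have hc1 : 1 ≤ c := by
    have : (0 : ℝ) ≤ n * (2 * q) := by positivity
    linarith
  refine ⟨P * ((2 + C) * (c ^ 2) ^ N) ^ P * (C * (c ^ 2) ^ N), 2 * N * P + 2 * N, by positivity,
    fun l k hk => ?_⟩
  have hk1 := one_le_vnorm hk
  have hk0 : 0 < vnorm k := one_pos.trans_le hk1
  have hW := one_le_latWeight l
  set U : ℝ := (c * latWeight l) ^ 2 with hU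
  have hU1 : 1 ≤ U := one_le_pow₀ (one_le_mul_of_one_le_of_one_le hc1 hW)
  have hUN : U ≤ U ^ N := le_self_pow₀ hU1 (by omega)
  have harg : ∀ i, |sqrtArg k (tildeVec l i)| ≤ U / vnorm k := fun i => by
    refine (abs_sqrtArg_le hk _).trans ?_
    have h1 := vnorm_tildeVec_le l i
    have h2 := vnorm_nonneg (tildeVec l i)
    have : 1 + vnorm (tildeVec l i) ≤ c * latWeight l := by
      rw [hc, add_mul, one_mul]
      linarith
    have : (1 + vnorm (tildeVec l i)) ^ 2 ≤ U := pow_le_pow_left₀ (by positivity) this 2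
    gcongr
  have hargU : ∀ i, |sqrtArg k (tildeVec l i)| ≤ U := fun i =>
    (harg i).trans (div_le_self (by linarith) hk1)
  set f : (Σ i, Fin (p i)) → ℝ := fun z => √(1 + sqrtArg k (tildeVec l z.1))
  set g : (Σ i, Fin (p i)) → ℝ := fun z =>
    ∑ a ∈ Finset.range N, Ring.choose (1 / 2 : ℝ) a * sqrtArg k (tildeVec l z.1) ^ a
  have hfg : ∀ z, |f z - g z| ≤ C * U ^ N / vnorm k ^ N := fun z => by
    refine (hC _).trans ?_
    rw [mul_div_assoc, ← div_pow]
    have := harg z.1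
    gcongr
  have hf : ∀ z, |f z| ≤ 2 * U ^ N := fun z => by
    rw [abs_of_nonneg (Real.sqrt_nonneg _)]
    have h3 : √(1 + sqrtArg k (tildeVec l z.1)) ≤ 1 + |sqrtArg k (tildeVec l z.1)| := by
      rw [Real.sqrt_le_left (by positivity)]
      nlinarith [abs_nonneg (sqrtArg k (tildeVec l z.1)), le_abs_self (sqrtArg k (tildeVec l z.1))]
    linarith [hargU z.1]
  have hg : ∀ z, |g z| ≤ (2 + C) * U ^ N := fun z => by
    have h1 : C * U ^ N / vnorm k ^ N ≤ C * U ^ N :=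
      div_le_self (by positivity) (one_le_pow₀ hk1)
    have h2 := abs_sub_abs_le_abs_sub (g z) (f z)
    rw [abs_sub_comm] at h2
    linarith [hfg z, hf z]
  have h := norm_prod_sub_prod_le_of_le Finset.univ f g (A := (2 + C) * U ^ N)
    (ε := C * U ^ N / vnorm k ^ N)
    (by nlinarith [one_le_pow₀ hU1 (n := N)])
    (fun z _ => (hf z).trans (by nlinarith [one_le_pow₀ hU1 (n := N)])) (fun z _ => hg z)
    (fun z _ => hfg z)
  have hcard : (Finset.univ : Finset (Σ i, Fin (p i))).card = P := by
    simp [hP]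
  rw [hcard, Real.norm_eq_abs, Fintype.prod_sigma, Fintype.prod_sigma] at h
  rw [prod_vnorm_add_eq p hk, truncProd, ← mul_sub, abs_mul, abs_of_pos (by positivity)]
  calc _ ≤ vnorm k ^ P * (P * ((2 + C) * U ^ N) ^ P * (C * U ^ N / vnorm k ^ N)) := by gcongr
    _ = _ := by
      have e1 : U ^ N = (c ^ 2) ^ N * latWeight l ^ (2 * N) := by
        rw [hU, mul_pow, mul_pow, ← pow_mul (latWeight l)]
      rw [e1, ← mul_assoc (2 + C), mul_pow _ _ P, ← pow_mul (latWeight l), pow_add]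
      ring

/-- The multi-indices `α` with all entries less than `N`. -/
def boxIdx (N : ℕ) : Finset (AIdx p) :=
  Fintype.piFinset fun _ => Fintype.piFinset fun _ => Finset.range N

variable {p}

theorem mem_boxIdx {N : ℕ} {α : AIdx p} : α ∈ boxIdx p N ↔ ∀ i j, α i j < N := by
  simp [boxIdx]

theorem truncProd_eq_sum (N : ℕ) (l : Lat n q) (k : Fin n → ℤ) :
    truncProd p N l k =
      ∑ α ∈ boxIdx p N, aBinom α * ∏ i, ∏ j, sqrtArg k (tildeVec l i) ^ α i j := by
  simp only [truncProd, boxIdx, Finset.prod_univ_sum, aBinom, Finset.prod_mul_distrib]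

/-- The point at which the variables `X`, `Y` take the values `k`, `l`. -/
noncomputable def evalPt (k : Fin n → ℤ) (l : Lat n q) : Var n q → ℝ :=
  Sum.elim (toReal k) fun z => (l z.1 z.2.1 z.2.2 : ℝ)

theorem eval_polyP {k : Fin n → ℤ} (hk : k ≠ 0) (l : Lat n q) (α : AIdx p) :
    MvPolynomial.eval (evalPt k l) (polyP n α) =
      vnorm k ^ (2 * aDeg α) * ∏ i, ∏ j, sqrtArg k (tildeVec l i) ^ α i j := by
  have hk0 : 0 < vnorm k := one_pos.trans_le (one_le_vnorm hk)
  have hY : ∀ i t, MvPolynomial.eval (evalPt k l) (tildeY i t) = (tildeVec l i t : ℝ) := by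
    intro i t
    simp [tildeY, tildeVec, evalPt, Finset.sum_apply]
  rw [pow_mul, aDeg, ← Finset.prod_pow_eq_pow_sum, ← Finset.prod_mul_distrib, polyP, map_prod]
  refine Finset.prod_congr rfl fun i _ => ?_
  rw [← Finset.prod_pow_eq_pow_sum, ← Finset.prod_mul_distrib, map_prod]
  refine Finset.prod_congr rfl fun j _ => ?_
  rw [map_pow, ← mul_pow]
  congr 1
  rw [sqrtArg, mul_div_cancel₀ _ (by positivity)]
  simp only [map_add, map_mul, map_sum, map_pow, hY, MvPolynomial.eval_X]
  simp [evalPt, toReal]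

/-- The polynomial `binom(1/2, α) P_α(X, Y) Q(X)`. -/
noncomputable def expPoly (Q : MvPolynomial (Fin n) ℝ) (α : AIdx p) : MvPolynomial (Var n q) ℝ :=
  MvPolynomial.C (aBinom α) * polyP n α * MvPolynomial.rename Sum.inl Q

theorem eval_expPoly (Q : MvPolynomial (Fin n) ℝ) (α : AIdx p) (k : Fin n → ℤ) (l : Lat n q) :
    MvPolynomial.eval (evalPt k l) (expPoly Q α) =
      ∑ β ∈ (expPoly Q α).support, coeffM Q α β l * ∏ t, (k t : ℝ) ^ β (Sum.inl t) := by
  rw [MvPolynomial.eval_eq']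
  refine Finset.sum_congr rfl fun β _ => ?_
  rw [Fintype.prod_sum_type, coeffM, coeffC, ← expPoly, mul_assoc,
    mul_comm (∏ e, ∏ j, ∏ t, _) (∏ t, _)]
  simp only [evalPt, Sum.elim_inl, Sum.elim_inr, Fintype.prod_prod_type, toReal]

/-- The pairs `(α, β)` with `α` in the box of size `N` and `X ^ β Y ^ β` occurring in
`binom(1/2, α) P_α(X, Y) Q(X)`. -/
noncomputable def pairIdx (p : Fin (q - 1) → ℕ) (Q : MvPolynomial (Fin n) ℝ) (N : ℕ) :
    Finset (AIdx p × (Var n q →₀ ℕ)) :=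
  open Classical in
  (boxIdx p N ×ˢ (boxIdx p N).biUnion fun α => (expPoly Q α).support).filter
    fun x => x.2 ∈ (expPoly Q x.1).support

theorem mem_pairIdx {Q : MvPolynomial (Fin n) ℝ} {N : ℕ} {x : AIdx p × (Var n q →₀ ℕ)} :
    x ∈ pairIdx p Q N ↔ x.1 ∈ boxIdx p N ∧ x.2 ∈ (expPoly Q x.1).support := by
  simp only [pairIdx, Finset.mem_filter, Finset.mem_product, Finset.mem_biUnion]
  exact ⟨fun h => ⟨h.1.1, h.2⟩, fun h => ⟨⟨h.1, x.1, h.1, h.2⟩, h.2⟩⟩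

theorem truncProd_mul_eval (Q : MvPolynomial (Fin n) ℝ) (N : ℕ) (l : Lat n q)
    {k : Fin n → ℤ} (hk : k ≠ 0) :
    truncProd p N l k * MvPolynomial.eval (toReal k) Q =
      ∑ x ∈ pairIdx p Q N, coeffM Q x.1 x.2 l * (∏ t, (k t : ℝ) ^ x.2 (Sum.inl t)) /
        vnorm k ^ (2 * aDeg x.1) := by
  have hk0 : 0 < vnorm k := one_pos.trans_le (one_le_vnorm hk)
  rw [Finset.sum_finset_product _ (boxIdx p N) (fun α => (expPoly Q α).support)
    (fun x => mem_pairIdx), truncProd_eq_sum, Finset.sum_mul]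
  refine Finset.sum_congr rfl fun α _ => ?_
  have h : MvPolynomial.eval (evalPt k l) (expPoly Q α) =
      aBinom α * (vnorm k ^ (2 * aDeg α) * ∏ i, ∏ j, sqrtArg k (tildeVec l i) ^ α i j) *
        MvPolynomial.eval (toReal k) Q := by
    rw [expPoly, map_mul, map_mul, MvPolynomial.eval_C, eval_polyP hk, MvPolynomial.eval_rename]
    rfl
  dsimp only
  rw [← Finset.sum_div, ← eval_expPoly, h]
  field_simp

/-! ### Degrees of the monomials of the expansion -/

/-- The degree of `Y ^ β`. -/
def yDeg (β : Var n q →₀ ℕ) : ℕ := ∑ z, β (Sum.inr z)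

theorem degree_eq_xDeg_add_yDeg (β : Var n q →₀ ℕ) : β.degree = xDeg β + yDeg β := by
  rw [Finsupp.degree_eq_sum, Fintype.sum_sum_type]
  rfl

/-- All monomials of `f` have degree at most `u` in `X` and at most `v` in `Y`. -/
def BidegLE (u v : ℕ) (f : MvPolynomial (Var n q) ℝ) : Prop :=
  ∀ β ∈ f.support, xDeg β ≤ u ∧ yDeg β ≤ v

theorem xDeg_add (β γ : Var n q →₀ ℕ) : xDeg (β + γ) = xDeg β + xDeg γ := by
  simp [xDeg, Finset.sum_add_distrib]

theorem yDeg_add (β γ : Var n q →₀ ℕ) : yDeg (β + γ) = yDeg β + yDeg γ := by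
  simp [yDeg, Finset.sum_add_distrib]

theorem BidegLE.mono {u v u' v' : ℕ} {f : MvPolynomial (Var n q) ℝ} (h : BidegLE u v f)
    (hu : u ≤ u') (hv : v ≤ v') : BidegLE u' v' f :=
  fun β hβ => ⟨(h β hβ).1.trans hu, (h β hβ).2.trans hv⟩

theorem BidegLE.add {u v : ℕ} {f g : MvPolynomial (Var n q) ℝ} (hf : BidegLE u v f)
    (hg : BidegLE u v g) : BidegLE u v (f + g) := by
  classical
  intro β hβ
  rcases Finset.mem_union.mp (MvPolynomial.support_add hβ) with h | h
  exacts [hf β h, hg β h]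

theorem BidegLE.mul {u v u' v' : ℕ} {f g : MvPolynomial (Var n q) ℝ} (hf : BidegLE u v f)
    (hg : BidegLE u' v' g) : BidegLE (u + u') (v + v') (f * g) := by
  classical
  intro β hβ
  obtain ⟨γ, hγ, δ, hδ, rfl⟩ := Finset.mem_add.mp (MvPolynomial.support_mul f g hβ)
  rw [xDeg_add, yDeg_add]
  exact ⟨add_le_add (hf γ hγ).1 (hg δ hδ).1, add_le_add (hf γ hγ).2 (hg δ hδ).2⟩

theorem BidegLE.C (c : ℝ) : BidegLE 0 0 (MvPolynomial.C c : MvPolynomial (Var n q) ℝ) := by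
  classical
  intro β hβ
  rw [MvPolynomial.mem_support_iff, MvPolynomial.coeff_C] at hβ
  have : β = 0 := by
    by_contra h
    exact hβ (if_neg (Ne.symm h))
  simp [this, xDeg, yDeg]

theorem BidegLE.sum {ι : Type*} {u v : ℕ} (s : Finset ι) {f : ι → MvPolynomial (Var n q) ℝ}
    (h : ∀ i ∈ s, BidegLE u v (f i)) : BidegLE u v (∑ i ∈ s, f i) := by
  classical
  induction s using Finset.induction_on with
  | empty => simp [BidegLE]
  | insert i s hi ih =>
    rw [Finset.sum_insert hi]
    exact (h i (Finset.mem_insert_self _ _)).add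
      (ih fun j hj => h j (Finset.mem_insert_of_mem hj))

theorem BidegLE.prod {ι : Type*} (s : Finset ι) {u v : ι → ℕ}
    {f : ι → MvPolynomial (Var n q) ℝ} (h : ∀ i ∈ s, BidegLE (u i) (v i) (f i)) :
    BidegLE (∑ i ∈ s, u i) (∑ i ∈ s, v i) (∏ i ∈ s, f i) := by
  classical
  induction s using Finset.induction_on with
  | empty => simpa using BidegLE.C (n := n) (q := q) 1
  | insert i s hi ih =>
    rw [Finset.prod_insert hi, Finset.sum_insert hi, Finset.sum_insert hi]
    exact (h i (Finset.mem_insert_self _ _)).mul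
      (ih fun j hj => h j (Finset.mem_insert_of_mem hj))

theorem BidegLE.pow {u v : ℕ} {f : MvPolynomial (Var n q) ℝ} (h : BidegLE u v f) (m : ℕ) :
    BidegLE (m * u) (m * v) (f ^ m) := by
  simpa using BidegLE.prod (Finset.range m) (fun _ _ => h)

theorem BidegLE.X_inl (t : Fin n) :
    BidegLE 1 0 (MvPolynomial.X (Sum.inl t) : MvPolynomial (Var n q) ℝ) := by
  classical
  intro β hβ
  rw [MvPolynomial.support_X, Finset.mem_singleton] at hβ
  subst hβ
  simp [xDeg, yDeg, Finsupp.single_apply]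

theorem BidegLE.X_inr (z : Fin 2 × Fin q × Fin n) :
    BidegLE 0 1 (MvPolynomial.X (Sum.inr z) : MvPolynomial (Var n q) ℝ) := by
  classical
  intro β hβ
  rw [MvPolynomial.support_X, Finset.mem_singleton] at hβ
  subst hβ
  simp [xDeg, yDeg, Finsupp.single_apply]

theorem BidegLE.tildeY (i : Fin (q - 1)) (t : Fin n) : BidegLE 0 1 (tildeY (n := n) i t) :=
  BidegLE.sum _ fun _ _ => (BidegLE.X_inr _).add (BidegLE.X_inr _)

theorem BidegLE.polyP (α : AIdx p) : BidegLE (aDeg α) (2 * aDeg α) (polyP n α) := by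
  have h2 : BidegLE 0 0 (2 : MvPolynomial (Var n q) ℝ) := by
    have := BidegLE.C (n := n) (q := q) 2
    rwa [map_ofNat] at this
  have h : ∀ i, BidegLE 1 2 (2 * (∑ t : Fin n, MvPolynomial.X (Sum.inl t) *
      TorusZeta.tildeY (q := q) i t) + ∑ t : Fin n, TorusZeta.tildeY i t ^ 2) := fun i =>
    ((h2.mul (BidegLE.sum _ fun t _ => (BidegLE.X_inl t).mul (BidegLE.tildeY i t))).mono
      (by norm_num) (by norm_num)).add
      ((BidegLE.sum _ fun t _ => (BidegLE.tildeY i t).pow 2).mono (by norm_num) (by norm_num))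
  have := BidegLE.prod Finset.univ fun i _ =>
    BidegLE.prod Finset.univ fun j _ => (h i).pow (α i j)
  refine this.mono ?_ ?_
  · simp [aDeg]
  · refine le_of_eq ?_
    simp only [aDeg, Finset.sum_mul, mul_comm 2]

theorem BidegLE.rename_inl (Q : MvPolynomial (Fin n) ℝ) :
    BidegLE Q.totalDegree 0 (MvPolynomial.rename Sum.inl Q : MvPolynomial (Var n q) ℝ) := by
  classical
  intro β hβ
  rw [MvPolynomial.mem_support_iff] at hβ
  obtain ⟨γ, rfl, hγ⟩ := MvPolynomial.coeff_rename_ne_zero _ _ _ hβ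
  constructor
  · have h := MvPolynomial.le_totalDegree (MvPolynomial.mem_support_iff.mpr hγ)
    rw [Finsupp.sum_fintype _ _ (fun _ => rfl)] at h
    simpa [xDeg, Finsupp.mapDomain_apply Sum.inl_injective] using h
  · simp only [yDeg]
    rw [Finset.sum_eq_zero]
    intro z _
    exact Finsupp.mapDomain_of_notMem_range _ _ (by simp)

theorem bidegLE_expPoly (Q : MvPolynomial (Fin n) ℝ) (α : AIdx p) :
    BidegLE (aDeg α + Q.totalDegree) (2 * aDeg α) (expPoly Q α) :=
  (((BidegLE.C _).mul (BidegLE.polyP α)).mul (BidegLE.rename_inl Q)).mono (by omega) (by omega)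

theorem setI_finite (Q : MvPolynomial (Fin n) ℝ) (m : ℕ) : (setI (n := n) p Q m).Finite := by
  have h : (setI (n := n) p Q m) ⊆ (boxIdx p (m + 1) : Set (AIdx p)) ×ˢ
      {β | β.degree ≤ 3 * m + Q.totalDegree} := by
    rintro ⟨α, β⟩ ⟨⟨h1, h2⟩, h3⟩
    simp only at h1 h2 h3
    have hα : aDeg α ≤ m := by omega
    refine ⟨?_, ?_⟩
    · rw [Finset.mem_coe, mem_boxIdx]
      intro i j
      have e1 : α i j ≤ ∑ j, α i j :=
        Finset.single_le_sum (f := fun j => α i j) (fun _ _ => Nat.zero_le _) (Finset.mem_univ j)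
      have e2 : ∑ j, α i j ≤ aDeg α :=
        Finset.single_le_sum (f := fun i => ∑ j, α i j) (fun _ _ => Nat.zero_le _)
          (Finset.mem_univ i)
      simp only
      omega
    · change β.degree ≤ _
      omega
  exact ((Finset.finite_toSet _).prod (Finsupp.finite_of_degree_le _)).subset h

end Expansion

/-! ### The Diophantine condition -/

section Assembly

variable {n q : ℕ}

/-- The vector `(2π)⁻¹ Θ (l_1 + ⋯ + l_q)`. -/
noncomputable def phaseVec (Θ : Matrix (Fin n) (Fin n) ℝ) (l : Lat n q) : Fin n → ℝ :=
  ((1 / (2 * π)) • Θ).mulVec (toReal (firstSum l))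

theorem exp_eq_latChar (Θ : Matrix (Fin n) (Fin n) ℝ) (l : Lat n q) (k : Fin n → ℤ) :
    Complex.exp (Complex.I * ((toReal k ⬝ᵥ Θ.mulVec (toReal (firstSum l)) : ℝ) : ℂ)) =
      latChar (phaseVec Θ l) k := by
  rw [latChar, phaseVec, Matrix.smul_mulVec, dotProduct_smul, smul_eq_mul]
  congr 1
  push_cast
  have : (π : ℂ) ≠ 0 := by exact_mod_cast Real.pi_ne_zero
  field_simp

/-- If `Θ / 2π` is badly approximable, then the vectors `phaseVec Θ l` with `l_1 + ⋯ + l_q ≠ 0` are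
separated from the integer vectors, at a polynomial rate: some fixed integer combination of the
coordinates of `phaseVec Θ l` is far from the integers, hence so is one of the coordinates. -/
theorem BadlyApproxMatrix.exists_weight {Θ : Matrix (Fin n) (Fin n) ℝ}
    (hΘ : BadlyApproxMatrix ((1 / (2 * π)) • Θ)) :
    ∃ (c : ℝ) (M : ℕ), 1 ≤ c ∧ ∀ l : Lat n q, firstSum l ≠ 0 →
      ∃ j, ∀ m : ℤ, (c * latWeight l ^ M)⁻¹ ≤ |phaseVec Θ l j + m| := by
  obtain ⟨u, δ, hδ, c₀, hc₀, h⟩ := hΘ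
  -- if all coordinates were within `ε` of an integer, then `u · x_l` would be within `S * ε` of
  -- one, while it has distance at least `c₀ * |l_1 + ⋯ + l_q| ^ (-δ)` to the integers
  set S : ℝ := ∑ j, |(u j : ℝ)|
  have hS : 0 ≤ S := Finset.sum_nonneg fun _ _ => abs_nonneg _
  set M := ⌈δ⌉₊
  refine ⟨max 1 ((1 + S) * (n * q : ℝ) ^ M / c₀), M, le_max_left _ _, fun l hl => ?_⟩
  have hw1 := one_le_vnorm hl
  have hw2 := vnorm_firstSum_le l
  have hW := one_le_latWeight l
  have hnq1 : 1 ≤ n * q * latWeight l := hw1.trans hw2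
  have hnqM : 0 < (n * q * latWeight l : ℝ) ^ M := by positivity
  by_contra! hcon
  choose m hm using hcon
  have h1 := h (firstSum l) hl (-∑ j, u j * m j)
  have e1 : toReal (firstSum l) ⬝ᵥ ((1 / (2 * π)) • Θ).transpose.mulVec (toReal u) -
      ((-∑ j, u j * m j : ℤ) : ℝ) = ∑ j, (u j : ℝ) * (phaseVec Θ l j + m j) := by
    rw [Matrix.dotProduct_mulVec, Matrix.vecMul_transpose, ← phaseVec]
    simp only [dotProduct, toReal]
    push_cast
    rw [sub_neg_eq_add, ← Finset.sum_add_distrib]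
    exact Finset.sum_congr rfl fun j _ => by ring
  rw [e1] at h1
  set ε := (max 1 ((1 + S) * (n * q : ℝ) ^ M / c₀) * latWeight l ^ M)⁻¹
  have hε0 : 0 < ε := by positivity
  have h2 : |∑ j, (u j : ℝ) * (phaseVec Θ l j + m j)| ≤ S * ε := by
    refine (Finset.abs_sum_le_sum_abs _ _).trans ?_
    rw [Finset.sum_mul]
    refine Finset.sum_le_sum fun j _ => ?_
    rw [abs_mul]
    exact mul_le_mul_of_nonneg_left (hm j).le (abs_nonneg _)
  have h3 : ((n * q * latWeight l : ℝ) ^ M)⁻¹ ≤ vnorm (firstSum l) ^ (-δ) := by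
    rw [Real.rpow_neg (vnorm_nonneg _)]
    refine inv_anti₀ (Real.rpow_pos_of_pos (by linarith) _) ?_
    calc vnorm (firstSum l) ^ δ ≤ vnorm (firstSum l) ^ (M : ℝ) :=
          Real.rpow_le_rpow_of_exponent_le hw1 (Nat.le_ceil δ)
      _ = vnorm (firstSum l) ^ M := Real.rpow_natCast _ _
      _ ≤ _ := pow_le_pow_left₀ (vnorm_nonneg _) hw2 M
  have h4 : (1 + S) * ε ≤ c₀ * ((n * q * latWeight l : ℝ) ^ M)⁻¹ := by
    rw [← div_eq_mul_inv, ← div_eq_mul_inv, div_le_div_iff₀ (by positivity) hnqM]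
    have := le_max_right 1 ((1 + S) * (n * q : ℝ) ^ M / c₀)
    rw [div_le_iff₀ hc₀] at this
    rw [mul_pow]
    calc (1 + S) * ((n * q : ℝ) ^ M * latWeight l ^ M) =
        ((1 + S) * (n * q : ℝ) ^ M) * latWeight l ^ M := by ring
      _ ≤ (max 1 ((1 + S) * (n * q : ℝ) ^ M / c₀) * c₀) * latWeight l ^ M := by gcongr
      _ = _ := by ring
  have h5 := mul_le_mul_of_nonneg_left h3 hc₀.le
  linarith

/-! ### Splitting the zeta function into Dirichlet series and a remainder -/

variable {p : Fin (q - 1) → ℕ}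

theorem norm_coeffM_le (Q : MvPolynomial (Fin n) ℝ) (α : AIdx p) (β : Var n q →₀ ℕ)
    (l : Lat n q) : |coeffM Q α β l| ≤ |coeffC Q α β| * latWeight l ^ yDeg β := by
  rw [coeffM, abs_mul]
  refine mul_le_mul_of_nonneg_left ?_ (abs_nonneg _)
  rw [yDeg, ← Finset.prod_pow_eq_pow_sum, Fintype.prod_prod_type]
  simp only [Fintype.prod_prod_type, Finset.abs_prod, abs_pow]
  refine Finset.prod_le_prod (fun _ _ => by positivity) fun e _ => ?_
  refine Finset.prod_le_prod (fun _ _ => by positivity) fun j _ => ?_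
  refine Finset.prod_le_prod (fun _ _ => by positivity) fun t _ => ?_
  exact pow_le_pow_left₀ (abs_nonneg _) (abs_coord_le_latWeight l e j t) _

theorem IsSchwartzSeq.summable_mul_coeffM {a : Lat n q → ℂ} (ha : IsSchwartzSeq a)
    (Q : MvPolynomial (Fin n) ℝ) (α : AIdx p) (β : Var n q →₀ ℕ) (N : ℕ) :
    Summable fun l => ‖a l * coeffM Q α β l‖ * latWeight l ^ N := by
  refine Summable.of_nonneg_of_le (fun l => ?_) (fun l => ?_)
    ((ha.summable (yDeg β + N)).mul_left |coeffC Q α β|)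
  · have := one_le_latWeight l
    positivity
  · have := one_le_latWeight l
    rw [norm_mul, Complex.norm_real, Real.norm_eq_abs]
    calc _ ≤ ‖a l‖ * (|coeffC Q α β| * latWeight l ^ yDeg β) * latWeight l ^ N := by
          gcongr
          exact norm_coeffM_le Q α β l
      _ = _ := by ring

/-- The integer `m = 2|α| - d_β + d` attached to `(α, β)`. -/
def pairDeg (Q : MvPolynomial (Fin n) ℝ) (x : AIdx p × (Var n q →₀ ℕ)) : ℕ :=
  2 * aDeg x.1 + Q.totalDegree - xDeg x.2

/-- The contribution of `(α, β)` to the residue. -/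
noncomputable def resPair (Q : MvPolynomial (Fin n) ℝ) (a : Lat n q → ℂ)
    (x : AIdx p × (Var n q →₀ ℕ)) : ℂ :=
  (∑' l : {l : Lat n q // firstSum l = 0}, a l * coeffM Q x.1 x.2 l) * sphereInt x.2

theorem xDeg_le_of_mem_pairIdx {Q : MvPolynomial (Fin n) ℝ} {N : ℕ}
    {x : AIdx p × (Var n q →₀ ℕ)} (hx : x ∈ pairIdx p Q N) :
    xDeg x.2 ≤ aDeg x.1 + Q.totalDegree ∧ yDeg x.2 ≤ 2 * aDeg x.1 :=
  bidegLE_expPoly Q x.1 x.2 (mem_pairIdx.mp hx).2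

/-- The summand of the zeta function in which the factors `|k + l̃_i|` are replaced by their
expansions, truncated at order `N`. -/
noncomputable def truncTerm (Θ : Matrix (Fin n) (Fin n) ℝ) (p : Fin (q - 1) → ℕ)
    (Q : MvPolynomial (Fin n) ℝ) (N : ℕ) (l : Lat n q) (k : Fin n → ℤ) (s : ℂ) : ℂ :=
  ((vnorm k ^ (∑ i, p i) * truncProd p N l k : ℝ) : ℂ) * (vnorm k : ℂ) ^ (-s) *
    ((MvPolynomial.eval (toReal k) Q : ℝ) : ℂ) *
    Complex.exp (Complex.I * ((toReal k ⬝ᵥ Θ.mulVec (toReal (firstSum l)) : ℝ) : ℂ))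

theorem truncTerm_eq_sum (Θ : Matrix (Fin n) (Fin n) ℝ) (Q : MvPolynomial (Fin n) ℝ) (N : ℕ)
    (l : Lat n q) {k : Fin n → ℤ} (hk : k ≠ 0) (s : ℂ) :
    truncTerm Θ p Q N l k s = ∑ x ∈ pairIdx p Q N, coeffM Q x.1 x.2 l *
      (latMono (fun t => x.2 (Sum.inl t)) k * latChar (phaseVec Θ l) k) *
        (vnorm k : ℂ) ^ (-(s - ((∑ i, p i : ℕ) : ℂ) + ((2 * aDeg x.1 : ℕ) : ℂ))) := by
  have hk0 : (vnorm k : ℂ) ≠ 0 := by exact_mod_cast (one_pos.trans_le (one_le_vnorm hk)).ne'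
  rw [truncTerm, exp_eq_latChar]
  have h1 := congrArg (fun y : ℝ => (y : ℂ)) (truncProd_mul_eval (p := p) Q N l hk)
  rw [Complex.ofReal_mul] at h1
  calc _ = ((truncProd p N l k : ℂ) * ((MvPolynomial.eval (toReal k) Q : ℝ) : ℂ)) *
        ((vnorm k : ℂ) ^ (∑ i, p i) * (vnorm k : ℂ) ^ (-s) * latChar (phaseVec Θ l) k) := by
        push_cast
        ring
    _ = _ := by
        rw [h1, Complex.ofReal_sum, Finset.sum_mul]
        refine Finset.sum_congr rfl fun x _ => ?_
        have e : -(s - ((∑ i, p i : ℕ) : ℂ) + ((2 * aDeg x.1 : ℕ) : ℂ)) =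
            ((∑ i, p i : ℕ) : ℂ) + -s - ((2 * aDeg x.1 : ℕ) : ℂ) := by ring
        rw [e, Complex.cpow_sub _ _ hk0, Complex.cpow_add _ _ hk0, Complex.cpow_natCast,
          Complex.cpow_natCast, latMono]
        push_cast
        ring

/-- The truncated zeta function is a finite sum of Dirichlet series, and hence equal to an entire
function plus finitely many simple polar terms. -/
theorem exists_truncTerm_continuation (hn : 1 ≤ n) {Θ : Matrix (Fin n) (Fin n) ℝ}
    (hΘ : BadlyApproxMatrix ((1 / (2 * π)) • Θ)) {a : Lat n q → ℂ} (ha : IsSchwartzSeq a)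
    (Q : MvPolynomial (Fin n) ℝ) (N : ℕ) :
    ∃ E : ℂ → ℂ, Differentiable ℂ E ∧
      ∀ s : ℂ, (n : ℝ) + Q.totalDegree + ((∑ i, p i : ℕ) : ℝ) < s.re →
        HasSum (fun i : Lat n q × {k : Fin n → ℤ // k ≠ 0} =>
          a i.1 * truncTerm Θ p Q N i.1 i.2 s)
          (E s + ∑ x ∈ pairIdx p Q N, resPair Q a x / (s - polePt n p Q (pairDeg Q x))) := by
  obtain ⟨c, M, hc, hsep⟩ := hΘ.exists_weight (q := q)
  have key : ∀ x : AIdx p × (Var n q →₀ ℕ), ∃ E : ℂ → ℂ, Differentiable ℂ E ∧ ∀ s : ℂ,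
      ((n + ∑ t, x.2 (Sum.inl t) : ℕ) : ℝ) < s.re →
      HasSum (fun i : Lat n q × {k : Fin n → ℤ // k ≠ 0} =>
        (a i.1 * coeffM Q x.1 x.2 i.1) *
          (latMono (fun t => x.2 (Sum.inl t)) i.2.1 * latChar (phaseVec Θ i.1) i.2.1) *
          (vnorm i.2.1 : ℂ) ^ (-s))
        (E s + resPair Q a x / (s - ((n + ∑ t, x.2 (Sum.inl t) : ℕ) : ℂ))) := by
    intro x
    refine exists_entire_continuation hn (W := fun l => c * latWeight l ^ M)
      (b := fun l => a l * coeffM Q x.1 x.2 l) (x := phaseVec Θ)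
      (Z := {l | firstSum l = 0}) (fun l => ?_) (fun K => ?_) (fun l hl => ?_) (fun l hl => ?_)
      (fun t => x.2 (Sum.inl t))
    · exact one_le_mul_of_one_le_of_one_le hc (one_le_pow₀ (one_le_latWeight l))
    · refine ((ha.summable_mul_coeffM Q x.1 x.2 (M * K)).mul_left (c ^ K)).congr fun l => ?_
      rw [mul_pow, pow_mul]
      ring
    · have h0 : toReal (firstSum l) = 0 := by
        rw [show firstSum l = 0 from hl]
        ext
        simp [toReal]
      rw [phaseVec, h0, Matrix.mulVec_zero]
    · exact hsep l hl
  choose E hE hEs using key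
  refine ⟨fun s => ∑ x ∈ pairIdx p Q N,
    E x (s - ((∑ i, p i : ℕ) : ℂ) + ((2 * aDeg x.1 : ℕ) : ℂ)), ?_, fun s hs => ?_⟩
  · refine Differentiable.fun_sum fun x _ => (hE x).comp ?_
    fun_prop
  · rw [← Finset.sum_add_distrib]
    have h := hasSum_sum (s := pairIdx p Q N) fun x hx =>
      hEs x (s - ((∑ i, p i : ℕ) : ℂ) + ((2 * aDeg x.1 : ℕ) : ℂ)) (by
        have h1 : (xDeg x.2 : ℝ) ≤ aDeg x.1 + Q.totalDegree := by
          exact_mod_cast (xDeg_le_of_mem_pairIdx hx).1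
        have h2 : (0 : ℝ) ≤ aDeg x.1 := Nat.cast_nonneg _
        rw [Complex.add_re, Complex.sub_re, Complex.natCast_re, Complex.natCast_re, ← xDeg]
        push_cast at hs ⊢
        linarith)
    convert! h using 1
    · ext i
      rw [truncTerm_eq_sum Θ Q N i.1 i.2.2, Finset.mul_sum]
      exact Finset.sum_congr rfl fun x _ => by ring
    · refine Finset.sum_congr rfl fun x hx => ?_
      congr 2
      have h1 := (xDeg_le_of_mem_pairIdx hx).1
      rw [polePt, pairDeg, Nat.cast_sub (by omega), ← xDeg]
      push_cast
      ring

theorem exists_abs_eval_le (Q : MvPolynomial (Fin n) ℝ) :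
    ∃ C : ℝ, 0 ≤ C ∧ ∀ k : Fin n → ℤ, k ≠ 0 →
      |MvPolynomial.eval (toReal k) Q| ≤ C * vnorm k ^ Q.totalDegree := by
  refine ⟨∑ d ∈ Q.support, |Q.coeff d|, Finset.sum_nonneg fun _ _ => abs_nonneg _, fun k hk => ?_⟩
  rw [MvPolynomial.eval_eq', Finset.sum_mul]
  refine (Finset.abs_sum_le_sum_abs _ _).trans (Finset.sum_le_sum fun d hd => ?_)
  rw [abs_mul]
  refine mul_le_mul_of_nonneg_left ?_ (abs_nonneg _)
  have h := MvPolynomial.le_totalDegree hd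
  rw [Finsupp.sum_fintype _ _ (fun _ => rfl)] at h
  refine le_trans ?_ (pow_le_pow_right₀ (one_le_vnorm hk) h)
  rw [Finset.abs_prod, ← Finset.prod_pow_eq_pow_sum]
  refine Finset.prod_le_prod (fun _ _ => abs_nonneg _) fun i _ => ?_
  rw [abs_pow]
  exact pow_le_pow_left₀ (abs_nonneg _) (abs_le_vnorm k i) _

/-- The remainder of the expansion is holomorphic on a half-plane extending by `N` to the left of
the half-plane of absolute convergence. -/
theorem exists_remainder {Θ : Matrix (Fin n) (Fin n) ℝ} {a : Lat n q → ℂ}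
    (ha : IsSchwartzSeq a) (Q : MvPolynomial (Fin n) ℝ) {N : ℕ} (hN : 1 ≤ N) :
    ∃ h : ℂ → ℂ,
      DifferentiableOn ℂ h {s | (n : ℝ) + Q.totalDegree + ((∑ i, p i : ℕ) : ℝ) - N < s.re} ∧
      ∀ s : ℂ, (n : ℝ) + Q.totalDegree + ((∑ i, p i : ℕ) : ℝ) - N < s.re →
        HasSum (fun i : Lat n q × {k : Fin n → ℤ // k ≠ 0} =>
          a i.1 * (zetaTerm Θ p Q i.1 i.2 s - truncTerm Θ p Q N i.1 i.2 s)) (h s) := by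
  obtain ⟨C, M, hC0, hC⟩ := exists_abs_prod_sub_truncProd_le p hN (n := n)
  obtain ⟨C', hC'0, hC'⟩ := exists_abs_eval_le Q
  set σ : ℝ := (n : ℝ) + Q.totalDegree + ((∑ i, p i : ℕ) : ℝ) - N with hσ
  let f : Lat n q × {k : Fin n → ℤ // k ≠ 0} → ℂ → ℂ := fun i s =>
    a i.1 * (zetaTerm Θ p Q i.1 i.2 s - truncTerm Θ p Q N i.1 i.2 s)
  have hf : ∀ i s, f i s = a i.1 * (((∏ j, vnorm (i.2.1 + tildeVec i.1 j) ^ p j -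
      vnorm i.2.1 ^ (∑ j, p j) * truncProd p N i.1 i.2.1 : ℝ) : ℂ) * (vnorm i.2.1 : ℂ) ^ (-s) *
      ((MvPolynomial.eval (toReal i.2.1) Q : ℝ) : ℂ) * latChar (phaseVec Θ i.1) i.2.1) := by
    intro i s
    simp only [f, zetaTerm, truncTerm, exp_eq_latChar]
    rw [Complex.ofReal_sub]
    ring
  have hbound : ∀ r : ℝ, ∀ i s, r ≤ s.re → ‖f i s‖ ≤ C * C' *
      ((‖a i.1‖ * latWeight i.1 ^ M) * vnorm i.2.1 ^ (-(r - σ + n))) := by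
    intro r i s hs
    have hk := one_le_vnorm i.2.2
    have hk0 : 0 < vnorm i.2.1 := one_pos.trans_le hk
    have hW := one_le_latWeight i.1
    rw [hf, norm_mul, norm_mul, norm_mul, norm_mul, norm_latChar, mul_one, Complex.norm_real,
      Complex.norm_real, Complex.norm_cpow_eq_rpow_re_of_pos hk0]
    have h1 := hC i.1 i.2.1 i.2.2
    have h2 := hC' i.2.1 i.2.2
    have h3 : vnorm i.2.1 ^ (-s).re ≤ vnorm i.2.1 ^ (-r) :=
      Real.rpow_le_rpow_of_exponent_le hk (by simpa using hs)
    have e : vnorm i.2.1 ^ (-(r - σ + n)) = vnorm i.2.1 ^ (∑ j, p j) / vnorm i.2.1 ^ N *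
        vnorm i.2.1 ^ (-r) * vnorm i.2.1 ^ Q.totalDegree := by
      rw [← Real.rpow_natCast, ← Real.rpow_natCast, ← Real.rpow_natCast, ← Real.rpow_sub hk0,
        ← Real.rpow_add hk0, ← Real.rpow_add hk0]
      congr 1
      rw [hσ]
      ring
    rw [e]
    calc _ ≤ ‖a i.1‖ * ((C * latWeight i.1 ^ M * (vnorm i.2.1 ^ (∑ j, p j) / vnorm i.2.1 ^ N)) *
          vnorm i.2.1 ^ (-r) * (C' * vnorm i.2.1 ^ Q.totalDegree)) := by
          gcongr
          · exact h1
          · exact h2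
      _ = _ := by ring
  have hsum : ∀ r : ℝ, σ < r → Summable fun i : Lat n q × {k : Fin n → ℤ // k ≠ 0} => C * C' *
      ((‖a i.1‖ * latWeight i.1 ^ M) * vnorm i.2.1 ^ (-(r - σ + n))) := by
    intro r hr
    refine Summable.mul_left _ ((ha.summable M).mul_of_nonneg
      (summable_vnorm_rpow (by linarith)) (fun l => ?_)
      (fun k => Real.rpow_nonneg (vnorm_nonneg _) _))
    have := one_le_latWeight l
    simp only [Pi.zero_apply]
    positivity
  refine ⟨fun s => ∑' i, f i s, fun s hs => ?_, fun s hs => ?_⟩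
  · obtain ⟨r, hr1, hr2⟩ := exists_between (show σ < s.re from hs)
    have hopen : IsOpen {z : ℂ | r < z.re} := isOpen_lt continuous_const Complex.continuous_re
    have h := Complex.differentiableOn_tsum_of_summable_norm (hsum r hr1) (F := f)
      (U := {z : ℂ | r < z.re}) (fun i => ?_) hopen (fun i z hz => hbound r i z (le_of_lt hz))
    · exact (h.differentiableAt (hopen.mem_nhds hr2)).differentiableWithinAt
    · have hk0 : (vnorm i.2.1 : ℂ) ≠ 0 := by
        exact_mod_cast (one_pos.trans_le (one_le_vnorm i.2.2)).ne'
      have : f i = fun s => a i.1 * (((∏ j, vnorm (i.2.1 + tildeVec i.1 j) ^ p j -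
          vnorm i.2.1 ^ (∑ j, p j) * truncProd p N i.1 i.2.1 : ℝ) : ℂ) * (vnorm i.2.1 : ℂ) ^ (-s) *
          ((MvPolynomial.eval (toReal i.2.1) Q : ℝ) : ℂ) * latChar (phaseVec Θ i.1) i.2.1) :=
        funext (hf i)
      rw [this]
      have hd : Differentiable ℂ fun s : ℂ => (vnorm i.2.1 : ℂ) ^ (-s) :=
        differentiable_neg.const_cpow (Or.inl hk0)
      exact (((((hd.const_mul _).mul_const _).mul_const _).const_mul _)).differentiableOn
  · exact (Summable.of_norm_bounded (hsum s.re hs) fun i => hbound s.re i s le_rfl).hasSum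

/-! ### The residues -/

theorem resTerm_eq_sum (Q : MvPolynomial (Fin n) ℝ) (a : Lat n q → ℂ) {m N : ℕ} (hm : m < N)
    (l : Lat n q) :
    resTerm p Q a m l = ∑ x ∈ (pairIdx p Q N).filter fun x => pairDeg Q x = m,
      a l * coeffM Q x.1 x.2 l * sphereInt x.2 := by
  have h : (∑ᶠ x ∈ setI p Q m, coeffM Q x.1 x.2 l * sphereInt x.2) =
      ∑ x ∈ (pairIdx p Q N).filter (fun x => pairDeg Q x = m),
        coeffM Q x.1 x.2 l * sphereInt x.2 := by
    refine finsum_mem_eq_sum_of_inter_support_eq _ ?_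
    ext x
    simp only [Set.mem_inter_iff, Finset.mem_coe, Finset.mem_filter, Function.mem_support]
    -- elements of `setI` need not occur in `expPoly`, but those that do not have coefficient `0`
    refine and_congr_left fun hx => ?_
    have hsupp : x.2 ∈ (expPoly Q x.1).support := by
      rw [MvPolynomial.mem_support_iff]
      intro h0
      refine hx ?_
      rw [coeffM, coeffC, ← expPoly, h0, zero_mul, zero_mul]
    have hdeg := bidegLE_expPoly Q x.1 x.2 hsupp
    have hd := degree_eq_xDeg_add_yDeg x.2
    constructor
    · rintro ⟨-, h2⟩
      have hα : aDeg x.1 ≤ m := by omega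
      refine ⟨mem_pairIdx.mpr ⟨mem_boxIdx.mpr fun i j => ?_, hsupp⟩, ?_⟩
      · have e1 : x.1 i j ≤ ∑ j, x.1 i j :=
          Finset.single_le_sum (f := fun j => x.1 i j) (fun _ _ => Nat.zero_le _)
            (Finset.mem_univ j)
        have e2 : ∑ j, x.1 i j ≤ aDeg x.1 :=
          Finset.single_le_sum (f := fun i => ∑ j, x.1 i j) (fun _ _ => Nat.zero_le _)
            (Finset.mem_univ i)
        omega
      · rw [pairDeg]
        omega
    · rintro ⟨-, h2⟩
      rw [pairDeg] at h2
      refine ⟨⟨?_, hdeg.1⟩, ?_⟩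
      · omega
      · omega
  rw [resTerm, h, Complex.ofReal_sum, Finset.mul_sum]
  refine Finset.sum_congr rfl fun x _ => ?_
  push_cast
  ring

theorem hasSum_resTerm {a : Lat n q → ℂ} (ha : IsSchwartzSeq a) (Q : MvPolynomial (Fin n) ℝ)
    {m N : ℕ} (hm : m < N) :
    HasSum (fun l : {l : Lat n q // firstSum l = 0} => resTerm p Q a m l)
      (∑ x ∈ (pairIdx p Q N).filter fun x => pairDeg Q x = m, resPair Q a x) := by
  simp only [resTerm_eq_sum Q a hm]
  refine hasSum_sum fun x _ => ?_
  have h : Summable fun l : Lat n q => a l * coeffM Q x.1 x.2 l := by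
    refine Summable.of_norm ?_
    simpa using ha.summable_mul_coeffM Q x.1 x.2 0
  exact (h.comp_injective Subtype.val_injective).hasSum.mul_right _

/-- On a half-plane extending by `N` to the left of the half-plane of absolute convergence, the
zeta function is the sum of a holomorphic function and of the polar terms at the first `N`
candidate poles. -/
theorem exists_zeta_decomposition (hn : 1 ≤ n) {Θ : Matrix (Fin n) (Fin n) ℝ}
    (hΘ : BadlyApproxMatrix ((1 / (2 * π)) • Θ)) {a : Lat n q → ℂ} (ha : IsSchwartzSeq a)
    (Q : MvPolynomial (Fin n) ℝ) {N : ℕ} (hN : 1 ≤ N) :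
    ∃ h : ℂ → ℂ,
      DifferentiableOn ℂ h {s | (n : ℝ) + Q.totalDegree + ((∑ i, p i : ℕ) : ℝ) - N < s.re} ∧
      ∀ s : ℂ, (n : ℝ) + Q.totalDegree + ((∑ i, p i : ℕ) : ℝ) < s.re →
        HasSum (fun i : Lat n q × {k : Fin n → ℤ // k ≠ 0} => a i.1 * zetaTerm Θ p Q i.1 i.2 s)
          (h s + ∑ m ∈ Finset.range N, resC p Q a m / (s - polePt n p Q m)) := by
  classical
  obtain ⟨E, hE, hEs⟩ := exists_truncTerm_continuation (p := p) hn hΘ ha Q N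
  obtain ⟨R, hR, hRs⟩ := exists_remainder (p := p) (Θ := Θ) ha Q hN
  set T := pairIdx p Q N
  refine ⟨fun s => E s + R s + ∑ x ∈ T.filter (fun x => ¬ pairDeg Q x < N),
    resPair Q a x / (s - polePt n p Q (pairDeg Q x)), ?_, fun s hs => ?_⟩
  · refine (hE.differentiableOn.add hR).add (DifferentiableOn.fun_sum fun x hx => ?_)
    refine DifferentiableOn.div (differentiableOn_const _) (by fun_prop) fun s hs h0 => ?_
    have hx' : (N : ℝ) ≤ pairDeg Q x := by
      exact_mod_cast not_lt.mp (Finset.mem_filter.mp hx).2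
    rw [sub_eq_zero] at h0
    have hs' : (n : ℝ) + Q.totalDegree + ((∑ i, p i : ℕ) : ℝ) - N < s.re := hs
    rw [h0, polePt] at hs'
    simp only [Complex.sub_re, Complex.add_re, Complex.natCast_re] at hs'
    linarith
  · have h := (hEs s hs).add (hRs s (by
      have : (0 : ℝ) ≤ N := Nat.cast_nonneg _
      linarith))
    convert! h using 1
    · ext i
      ring
    · have h1 := Finset.sum_filter_add_sum_filter_not T (fun x => pairDeg Q x < N)
        (fun x => resPair Q a x / (s - polePt n p Q (pairDeg Q x)))
      have h2 : ∑ x ∈ T.filter (fun x => pairDeg Q x < N),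
          resPair Q a x / (s - polePt n p Q (pairDeg Q x)) =
          ∑ m ∈ Finset.range N, resC p Q a m / (s - polePt n p Q m) := by
        rw [← Finset.sum_fiberwise_of_maps_to (t := Finset.range N) (g := pairDeg Q)
          (fun x hx => Finset.mem_range.mpr (Finset.mem_filter.mp hx).2)]
        refine Finset.sum_congr rfl fun m hm => ?_
        have hm' := Finset.mem_range.mp hm
        rw [resC, (hasSum_resTerm ha Q hm').tsum_eq, Finset.sum_div, Finset.filter_filter]
        have hfilt : T.filter (fun x => pairDeg Q x < N ∧ pairDeg Q x = m) =
            T.filter (fun x => pairDeg Q x = m) := by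
          refine Finset.filter_congr fun x _ => ?_
          exact ⟨fun h => h.2, fun h => ⟨h ▸ hm', h⟩⟩
        rw [hfilt]
        refine Finset.sum_congr rfl fun x hx => ?_
        rw [(Finset.mem_filter.mp hx).2]
      rw [← h1, h2]
      ring

end Assembly

/-! ### Simple poles and gluing of continuations -/

/-- The local behaviour of a function which is the sum of an analytic function and of a simple
polar term. -/
theorem simplePole_facts {F G : ℂ → ℂ} {z c : ℂ} (hG : AnalyticAt ℂ G z)
    (hF : F =ᶠ[𝓝 z] fun s => G s + c / (s - z)) :
    MeromorphicAt F z ∧ -1 ≤ meromorphicOrderAt F z ∧ (meromorphicOrderAt F z < 0 ↔ c ≠ 0) ∧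
      (c ≠ 0 → meromorphicOrderAt F z = -1) ∧ HasResidueAt F z c := by
  have hid : AnalyticAt ℂ (fun s : ℂ => s - z) z := by fun_prop
  have hmero : MeromorphicAt F z := by
    refine (MeromorphicAt.congr ?_ (hF.filter_mono nhdsWithin_le_nhds).symm)
    exact hG.meromorphicAt.add ((MeromorphicAt.const c z).div hid.meromorphicAt)
  have hcase : (c = 0 → 0 ≤ meromorphicOrderAt F z) ∧
      (c ≠ 0 → meromorphicOrderAt F z = -1) := by
    constructor
    · rintro rfl
      have : AnalyticAt ℂ F z := hG.congr (hF.mono fun s hs => by simp [hs])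
      exact this.meromorphicOrderAt_nonneg
    · intro hc
      have := (meromorphicOrderAt_eq_int_iff (n := -1) hmero).mpr
        ⟨fun s => (s - z) * G s + c, (hid.mul hG).add analyticAt_const, by simpa using hc, ?_⟩
      · exact_mod_cast this
      · filter_upwards [hF.filter_mono nhdsWithin_le_nhds, self_mem_nhdsWithin] with s hs hne
        have : s - z ≠ 0 := sub_ne_zero.mpr hne
        rw [hs, zpow_neg_one, smul_eq_mul]
        field_simp
  refine ⟨hmero, ?_, ?_, hcase.2, hmero, ?_⟩
  · by_cases hc : c = 0
    · exact le_trans (by decide) (hcase.1 hc)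
    · exact (hcase.2 hc).ge
  · constructor
    · rintro h rfl
      exact absurd (hcase.1 rfl) (not_le.mpr h)
    · intro hc
      rw [hcase.2 hc]
      decide
  · obtain ⟨ε, hε, hball⟩ := Metric.eventually_nhds_iff_ball.mp
      (hF.and hG.eventually_analyticAt)
    filter_upwards [Ioo_mem_nhdsGT hε] with r hr
    have hcb : Metric.closedBall z r ⊆ Metric.ball z ε := Metric.closedBall_subset_ball hr.2
    have hsb : Metric.sphere z r ⊆ Metric.ball z ε := Metric.sphere_subset_closedBall.trans hcb
    have h1 : (∮ w in C(z, r), F w) = ∮ w in C(z, r), (G w + c * (w - z)⁻¹) := by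
      refine circleIntegral.integral_congr hr.1.le fun w hw => ?_
      rw [(hball w (hsb hw)).1]
      simp only [div_eq_mul_inv]
    have hGd : DifferentiableOn ℂ G (Metric.closedBall z r) := fun w hw =>
      (hball w (hcb hw)).2.differentiableAt.differentiableWithinAt
    have h2 : (∮ w in C(z, r), G w) = 0 :=
      (hGd.diffContOnCl_ball subset_rfl).circleIntegral_eq_zero hr.1.le
    have hGi : CircleIntegrable G z r :=
      (hGd.continuousOn.mono Metric.sphere_subset_closedBall).circleIntegrable hr.1.le
    have hci : CircleIntegrable (fun w => c * (w - z)⁻¹) z r := by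
      refine ContinuousOn.circleIntegrable hr.1.le ?_
      refine continuousOn_const.mul (ContinuousOn.inv₀ (by fun_prop) fun w hw h0 => ?_)
      rw [sub_eq_zero.mp h0] at hw
      simp at hw
      exact hr.1.ne hw
    rw [h1, circleIntegral.integral_add hGi hci, h2, zero_add,
      circleIntegral.integral_const_mul, circleIntegral.integral_sub_center_inv z hr.1.ne']
    have : (2 * π * Complex.I : ℂ) ≠ 0 := Complex.two_pi_I_ne_zero
    field_simp

theorem isOpen_lt_re (σ : ℝ) : IsOpen {s : ℂ | σ < s.re} :=
  isOpen_lt continuous_const Complex.continuous_re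

/-- Continuations to half-planes `σ - N < Re s` with prescribed polar terms at the points `σ - m`,
`m < N`, glue to a function on the whole plane. -/
theorem exists_glued_continuation {σ : ℝ} {f : ℂ → ℂ} {r pt : ℕ → ℂ}
    (hpt : ∀ m : ℕ, (pt m).re = σ - m)
    (H : ∀ N : ℕ, 1 ≤ N → ∃ h : ℂ → ℂ, DifferentiableOn ℂ h {s | σ - N < s.re} ∧
      ∀ s : ℂ, σ < s.re → f s = h s + ∑ m ∈ Finset.range N, r m / (s - pt m)) :
    ∃ F : ℂ → ℂ, (∀ s : ℂ, σ < s.re → F s = f s) ∧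
      ∀ N : ℕ, 1 ≤ N → ∃ h : ℂ → ℂ, DifferentiableOn ℂ h {s | σ - N < s.re} ∧
        ∀ s : ℂ, σ - N < s.re → F s = h s + ∑ m ∈ Finset.range N, r m / (s - pt m) := by
  choose! h hd hf using H
  have hle : ∀ N N' : ℕ, 1 ≤ N → N ≤ N' → ∀ s : ℂ, σ - N < s.re →
      h N s + ∑ m ∈ Finset.range N, r m / (s - pt m) =
        h N' s + ∑ m ∈ Finset.range N', r m / (s - pt m) := by
    intro N N' hN hNN' s hs
    -- the difference is holomorphic on the smaller half-plane, since the additional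
    -- polar terms have their poles outside
    set g : ℂ → ℂ := fun s => h N' s + ∑ m ∈ Finset.Ico N N', r m / (s - pt m)
    have hNN : (N : ℝ) ≤ N' := by exact_mod_cast hNN'
    have hgd : DifferentiableOn ℂ g {s | σ - N < s.re} := by
      refine ((hd N' (hN.trans hNN')).mono fun z (hz : σ - N < z.re) => ?_).add
        (DifferentiableOn.fun_sum fun m hm => ?_)
      · change σ - N' < z.re
        linarith
      · refine DifferentiableOn.div (differentiableOn_const _) (by fun_prop)
          fun z (hz : σ - N < z.re) h0 => ?_
        rw [sub_eq_zero.mp h0, hpt] at hz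
        have : (N : ℝ) ≤ m := by exact_mod_cast (Finset.mem_Ico.mp hm).1
        linarith
    have hN0 : (0 : ℝ) ≤ N := Nat.cast_nonneg _
    have hz₀ : σ < ((σ + 1 : ℝ) : ℂ).re := by simp
    have heq : Set.EqOn (h N) g {s | σ - N < s.re} := by
      refine AnalyticOnNhd.eqOn_of_preconnected_of_eventuallyEq
        ((hd N hN).analyticOnNhd (isOpen_lt_re _)) (hgd.analyticOnNhd (isOpen_lt_re _))
        (convex_halfSpace_re_gt _).isPreconnected (z₀ := ((σ + 1 : ℝ) : ℂ))
        (show σ - N < ((σ + 1 : ℝ) : ℂ).re by linarith) ?_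
      filter_upwards [(isOpen_lt_re σ).mem_nhds hz₀] with z hz
      have h1 := hf N hN z hz
      have h2 := hf N' (hN.trans hNN') z hz
      rw [← Finset.sum_range_add_sum_Ico _ hNN'] at h2
      simp only [g]
      linear_combination h2 - h1
    rw [heq hs, ← Finset.sum_range_add_sum_Ico _ hNN']
    ring
  refine ⟨fun s => h (⌊σ - s.re⌋₊ + 1) s +
    ∑ m ∈ Finset.range (⌊σ - s.re⌋₊ + 1), r m / (s - pt m), fun s hs => ?_, fun N hN => ?_⟩
  · exact (hf _ (by omega) s hs).symm
  · refine ⟨h N, hd N hN, fun s hs => ?_⟩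
    have hs' : σ - ((⌊σ - s.re⌋₊ + 1 : ℕ) : ℝ) < s.re := by
      have := Nat.lt_floor_add_one (σ - s.re)
      push_cast
      linarith
    rcases le_total N (⌊σ - s.re⌋₊ + 1) with hle' | hle'
    · exact (hle N _ hN hle' s hs).symm
    · exact hle _ N (by omega) hle' s hs'

theorem polePt_re {n q : ℕ} (p : Fin (q - 1) → ℕ) (Q : MvPolynomial (Fin n) ℝ) (m : ℕ) :
    (polePt n p Q m).re = (n : ℝ) + Q.totalDegree + ((∑ i, p i : ℕ) : ℝ) - m := by
  simp only [polePt, Complex.sub_re, Complex.add_re, Complex.natCast_re]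

end TorusZeta

theorem mainTheorem4 (n q : ℕ) (hn : 1 ≤ n) (hq : 2 ≤ q) (p : Fin (q - 1) → ℕ)
    (hp : ∃ i, p i ≠ 0) (Q : MvPolynomial (Fin n) ℝ)
    (Θ : Matrix (Fin n) (Fin n) ℝ)
    (hΘ : TorusZeta.BadlyApproxMatrix ((1 / (2 * π)) • Θ))
    (a : TorusZeta.Lat n q → ℂ) (ha : TorusZeta.IsSchwartzSeq a) :
    -- absolute convergence of the defining double series in a half-plane
    (∀ s : ℂ, (n : ℝ) + Q.totalDegree + ((∑ i, p i : ℕ) : ℝ) < s.re →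
      Summable fun x : TorusZeta.Lat n q × {k : Fin n → ℤ // k ≠ 0} =>
        a x.1 * TorusZeta.zetaTerm Θ p Q x.1 x.2 s) ∧
    ∃ F : ℂ → ℂ,
      -- (i) `F` is a meromorphic continuation, with at most simple poles, all in the given set
      Meromorphic F ∧
      (∀ s : ℂ, (n : ℝ) + Q.totalDegree + ((∑ i, p i : ℕ) : ℝ) < s.re →
        F s = TorusZeta.zetaFun Θ p Q a s) ∧
      (∀ s : ℂ, (∀ m : ℕ, s ≠ TorusZeta.polePt n p Q m) → AnalyticAt ℂ F s) ∧
      (∀ m : ℕ, -1 ≤ meromorphicOrderAt F (TorusZeta.polePt n p Q m)) ∧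
      -- (ii) the poles and the residues
      ∀ m : ℕ,
        (TorusZeta.setI (n := n) p Q m).Finite ∧
        (Summable fun l : {l : TorusZeta.Lat n q // TorusZeta.firstSum l = 0} =>
          TorusZeta.resTerm p Q a m l) ∧
        (meromorphicOrderAt F (TorusZeta.polePt n p Q m) < 0 ↔ TorusZeta.resC p Q a m ≠ 0) ∧
        (TorusZeta.resC p Q a m ≠ 0 →
          meromorphicOrderAt F (TorusZeta.polePt n p Q m) = -1) ∧
        TorusZeta.HasResidueAt F (TorusZeta.polePt n p Q m) (TorusZeta.resC p Q a m) := by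
  open TorusZeta in
  set σ : ℝ := (n : ℝ) + Q.totalDegree + ((∑ i, p i : ℕ) : ℝ) with hσ
  have hsummable : ∀ s : ℂ, σ < s.re →
      Summable fun x : Lat n q × {k : Fin n → ℤ // k ≠ 0} => a x.1 * zetaTerm Θ p Q x.1 x.2 s := by
    intro s hs
    obtain ⟨h, -, h2⟩ := exists_zeta_decomposition (p := p) hn hΘ ha Q le_rfl
    exact (h2 s hs).summable
  have hzeta : ∀ s : ℂ, σ < s.re → ∑' x : Lat n q × {k : Fin n → ℤ // k ≠ 0},
      a x.1 * zetaTerm Θ p Q x.1 x.2 s = zetaFun Θ p Q a s := by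
    intro s hs
    rw [(hsummable s hs).tsum_prod, zetaFun]
    refine tsum_congr fun l => ?_
    dsimp only
    exact tsum_mul_left
  obtain ⟨F, hFf, hF⟩ := exists_glued_continuation (σ := σ) (f := zetaFun Θ p Q a)
    (r := resC p Q a) (pt := polePt n p Q) (polePt_re p Q) (fun N hN => by
      obtain ⟨h, h1, h2⟩ := exists_zeta_decomposition (p := p) hn hΘ ha Q hN
      exact ⟨h, h1, fun s hs => by rw [← hzeta s hs, (h2 s hs).tsum_eq]⟩)
  have hinj : ∀ m m' : ℕ, polePt n p Q m = polePt n p Q m' → m = m' := by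
    intro m m' h
    have := congrArg Complex.re h
    rw [polePt_re, polePt_re] at this
    have h' : (m : ℝ) = m' := by linarith
    exact_mod_cast h'
  have hreg : ∀ s : ℂ, (∀ m : ℕ, s ≠ polePt n p Q m) → AnalyticAt ℂ F s := by
    intro s hs
    obtain ⟨N, hN⟩ := exists_nat_gt (σ - s.re)
    have hs1 : σ - ((N + 1 : ℕ) : ℝ) < s.re := by
      push_cast
      linarith
    obtain ⟨h, hd, hh⟩ := hF (N + 1) (by omega)
    have hnhds := (isOpen_lt_re (σ - ((N + 1 : ℕ) : ℝ))).mem_nhds hs1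
    have han : AnalyticAt ℂ
        (fun z => h z + ∑ m ∈ Finset.range (N + 1), resC p Q a m / (z - polePt n p Q m)) s := by
      refine (hd.analyticAt hnhds).fun_add (Finset.analyticAt_fun_sum _ fun m _ => ?_)
      exact analyticAt_const.fun_div (by fun_prop) (sub_ne_zero.mpr (hs m))
    refine han.congr ?_
    filter_upwards [hnhds] with z hz
    exact (hh z hz).symm
  have hpole : ∀ m : ℕ, ∃ G : ℂ → ℂ, AnalyticAt ℂ G (polePt n p Q m) ∧
      F =ᶠ[𝓝 (polePt n p Q m)] fun s => G s + resC p Q a m / (s - polePt n p Q m) := by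
    intro m
    have hs1 : σ - ((m + 1 : ℕ) : ℝ) < (polePt n p Q m).re := by
      rw [polePt_re, ← hσ, Nat.cast_succ]
      linarith
    obtain ⟨h, hd, hh⟩ := hF (m + 1) (by omega)
    have hnhds := (isOpen_lt_re (σ - ((m + 1 : ℕ) : ℝ))).mem_nhds hs1
    refine ⟨fun z => h z + ∑ j ∈ Finset.range m, resC p Q a j / (z - polePt n p Q j), ?_, ?_⟩
    · refine (hd.analyticAt hnhds).fun_add (Finset.analyticAt_fun_sum _ fun j hj => ?_)
      refine analyticAt_const.fun_div (by fun_prop) (sub_ne_zero.mpr fun h0 => ?_)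
      exact absurd (hinj _ _ h0) (Finset.mem_range.mp hj).ne'
    · filter_upwards [hnhds] with z hz
      rw [hh z hz, Finset.sum_range_succ, add_assoc]
  have hfacts := fun m => simplePole_facts (hpole m).choose_spec.1 (hpole m).choose_spec.2
  refine ⟨hsummable, F, fun s => ?_, hFf, hreg, fun m => (hfacts m).2.1, fun m =>
    ⟨setI_finite Q m, (hasSum_resTerm ha Q (Nat.lt_succ_self m)).summable, (hfacts m).2.2.1,
      (hfacts m).2.2.2.1, (hfacts m).2.2.2.2⟩⟩
  by_cases hs : ∀ m : ℕ, s ≠ polePt n p Q m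
  · exact (hreg s hs).meromorphicAt
  · push Not at hs
    obtain ⟨m, rfl⟩ := hs
    exact (hfacts m).1
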